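/- Let $(\Omega,\mathcal F,P)$ be a probability space, $\mathbf I=\{1,\dots,d\}$, $\mathbf J=\{1,\dots,J\}$, $p_0=dJ$, and let $\Theta\subset\mathbb R^{p_0}$ be open and bounded with $\theta^*\in\Theta$; write $\theta=(\theta^\alpha_j)_{\alpha\in\mathbf I,\,j\in\mathbf J}$. Let $X=(X^j)_{j\in\mathbf J}$ be a $J$-dimensional stochastic process on $\mathbb R_+=[0,\infty)$ with left-continuous paths such that (1) $X$ is (strictly) stationary and $E[\exp(uX^j_0)]<\infty$ for all $u\in\mathbb R$ and $j\in\mathbf J$; (2) there is $a>0$ such that for all $h>0$ $$\sup\big\{|P(A\cap B)-P(A)P(B)| : t\ge 0,\ A\in\mathcal B_{[0,t]},\ B\in\mathcal B_{[t+h,\infty)}\big\}\le a^{-1}e^{-ah},$$ where $\mathcal B_S$ denotes the $\sigma$-field generated by $\{X^j_t : t\in S,\ j\in\mathbf J\}$. For $\alpha\in\mathbf I$ let $\lambda^\alpha(t,\theta)=\exp\big(\sum_{j\in\mathbf J}\theta^\alpha_jX^j_t\big)$ (the intensities of a Cox-type process), and let $\partial_\theta\lambda^\alpha(t,\theta)\in\mathbb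 R^{p_0}$ be the gradient in $\theta$. Write $\|\cdot\|_p$ for the norm of $L^p(P)$. Then: (A) (Ergodic-limit condition.) There exist probability measures $\nu^\alpha(\cdot,\theta)$ on $\mathbb R_+\times\mathbb R_+\times\mathbb R^{p_0}$ ($\alpha\in\mathbf I$, $\theta\in\Theta$) and $0<\delta<\tfrac12$ such that for every $\alpha\in\mathbf I$, every real $p>1$ and every bounded continuous $f:\mathbb R_+\times\mathbb R_+\times\mathbb R^{p_0}\to\mathbb R$, $$\sup_{\theta\in\Theta}T^{\delta}\Big\|\frac1T\int_0^Tf\big(\lambda^\alpha(t,\theta^*),\lambda^\alpha(t,\theta),\partial_\theta\lambda^\alpha(t,\theta)\big)\,dt-\int f(x,y,z)\,\nu^\alpha(dx,dy,dz,\theta)\Big\|_p\longrightarrow0\qquad(T\to\infty).$$ (B) (Rate.) For every $\alpha\in\mathbf I$ and every continuous $f:\mathbb R_+\times\mathbb R_+\times\mathbb R^{p_0}\to\mathbb R$ of at most polynomial growth, and for all $\theta\in\Theta$: the random variable $f(\lambda^\alpha(0,\theta^*),\lambda^\alpha(0,\theta),\partial_\theta\lambda^\alpha(0,\theta))$ is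 integrable; for every $T>0$ the time integral below exists almost surely and the time average is in $L^p(P)$ for every real $p\ge1$. Moreover, for every real $p\ge1$ there is a constant $C$, not depending on $T$ or $\theta$, such that for all $T\ge1$ $$\sup_{\theta\in\Theta}\Big\|\frac1T\int_0^Tf\big(\lambda^\alpha(t,\theta^*),\lambda^\alpha(t,\theta),\partial_\theta\lambda^\alpha(t,\theta)\big)\,dt-E\big[f\big(\lambda^\alpha(0,\theta^*),\lambda^\alpha(0,\theta),\partial_\theta\lambda^\alpha(0,\theta)\big)\big]\Big\|_p\le C\,T^{-1/2}.$$ -/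

import Mathlib

open MeasureTheory Filter Topology
open scoped NNReal ENNReal BoundedContinuousFunction

noncomputable section

/-- The state space `ℝ₊ × ℝ₊ × ℝ^p`, the coordinates of `ℝ^p` being indexed by `κ`. -/
abbrev IntensityState (κ : Type*) : Type _ := ℝ≥0 × ℝ≥0 × EuclideanSpace ℝ κ

/-- The triple `(λ^α(t,θ*), λ^α(t,θ), ∂_θ λ^α(t,θ))` of a parametric family of intensities
`lam α t θ ω`; `∂_θ` is the gradient in the whole parameter `θ`. -/
def intensityTriple {Ω ι κ : Type*} [Fintype κ]
    (lam : ι → ℝ≥0 → EuclideanSpace ℝ κ → Ω → ℝ≥0) (θstar : EuclideanSpace ℝ κ)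
    (α : ι) (θ : EuclideanSpace ℝ κ) (t : ℝ≥0) (ω : Ω) : IntensityState κ :=
  (lam α t θstar ω, lam α t θ ω, gradient (fun η => (lam α t η ω : ℝ)) θ)

/-- The time average `T⁻¹ ∫₀ᵀ f(λ^α(t,θ*), λ^α(t,θ), ∂_θ λ^α(t,θ)) dt`. -/
def timeAverage {Ω ι κ : Type*} [Fintype κ]
    (lam : ι → ℝ≥0 → EuclideanSpace ℝ κ → Ω → ℝ≥0) (θstar : EuclideanSpace ℝ κ)
    (f : IntensityState κ → ℝ) (α : ι) (θ : EuclideanSpace ℝ κ) (T : ℝ) (ω : Ω) : ℝ :=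
  T⁻¹ * ∫ t in (0 : ℝ)..T, f (intensityTriple lam θstar α θ t.toNNReal ω)

/-- The ergodic-limit condition for a parametric family of intensities: there are probability
measures `ν^α(·,θ)` on `ℝ₊ × ℝ₊ × ℝ^p` and `0 < δ < 1/2` such that, for all `α`, all `p > 1` and
all bounded continuous `f`,
`sup_{θ ∈ Θ} T^δ ‖T⁻¹ ∫₀ᵀ f(λ^α(t,θ*), λ^α(t,θ), ∂_θ λ^α(t,θ)) dt - ∫ f dν^α(·,θ)‖_p → 0`
as `T → ∞`. -/
def ErgodicLimitCondition {Ω ι κ : Type*} [MeasurableSpace Ω] [Fintype κ] (P : Measure Ω)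
    (lam : ι → ℝ≥0 → EuclideanSpace ℝ κ → Ω → ℝ≥0) (Θ : Set (EuclideanSpace ℝ κ))
    (θstar : EuclideanSpace ℝ κ) : Prop :=
  ∃ ν : ι → EuclideanSpace ℝ κ → ProbabilityMeasure (IntensityState κ),
  ∃ δ : ℝ, 0 < δ ∧ δ < 1 / 2 ∧
    ∀ (α : ι) (p : ℝ), 1 < p → ∀ f : IntensityState κ →ᵇ ℝ,
      Tendsto
        (fun T : ℝ => ⨆ θ ∈ Θ, ENNReal.ofReal (T ^ δ) *
          eLpNorm (fun ω => timeAverage lam θstar f α θ T ω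
            - ∫ w, f w ∂(ν α θ : Measure (IntensityState κ))) (ENNReal.ofReal p) P)
        atTop (𝓝 0)

/-- Continuous functions on `ℝ₊ × ℝ₊ × ℝ^p` of at most polynomial growth. -/
def ContinuousPolyGrowth {κ : Type*} [Fintype κ] (f : IntensityState κ → ℝ) : Prop :=
  Continuous f ∧ ∃ (C : ℝ) (k : ℕ), ∀ (x y : ℝ≥0) (z : EuclideanSpace ℝ κ),
    |f (x, y, z)| ≤ C * (1 + x + y + ‖z‖) ^ k

/-- The Cox-type intensities `λ^α(t,θ) = exp(∑_j θ^α_j X^j_t)`, `α = 1, …, d`, with parameter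
`θ = (θ^α_j) ∈ ℝ^(d J)`. -/
def coxIntensity {Ω : Type*} {d J : ℕ} (X : ℝ≥0 → Ω → Fin J → ℝ) (α : Fin d) (t : ℝ≥0)
    (θ : EuclideanSpace ℝ (Fin d × Fin J)) (ω : Ω) : ℝ≥0 :=
  ⟨Real.exp (∑ j, θ (α, j) * X t ω j), (Real.exp_pos _).le⟩

/-- (Strict) stationarity: the shifted process `(X_{t+h})_{t ≥ 0}` has the same law on path space
as `(X_t)_{t ≥ 0}`, for every `h ≥ 0`. -/
def IsStationaryProcess {Ω E : Type*} [MeasurableSpace Ω] [MeasurableSpace E] (P : Measure Ω)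
    (X : ℝ≥0 → Ω → E) : Prop :=
  ∀ h : ℝ≥0, P.map (fun ω t => X (t + h) ω) = P.map (fun ω t => X t ω)

/-- The `σ`-field `𝓑_S` generated by `X_t`, `t ∈ S`. -/
@[reducible] def sigmaFieldOn {Ω E : Type*} [mE : MeasurableSpace E] (X : ℝ≥0 → Ω → E) (S : Set ℝ≥0) :
    MeasurableSpace Ω :=
  ⨆ t ∈ S, MeasurableSpace.comap (X t) mE

/-- The strong mixing coefficient
`α(h) = sup { |P(A ∩ B) - P(A) P(B)| : t ≥ 0, A ∈ 𝓑_{[0,t]}, B ∈ 𝓑_{[t+h,∞)} }`. -/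
def mixingCoeff {Ω E : Type*} [MeasurableSpace Ω] [MeasurableSpace E] (P : Measure Ω)
    (X : ℝ≥0 → Ω → E) (h : ℝ≥0) : ℝ :=
  sSup {r : ℝ | ∃ (t : ℝ≥0) (A B : Set Ω),
    MeasurableSet[sigmaFieldOn X (Set.Icc 0 t)] A ∧
    MeasurableSet[sigmaFieldOn X (Set.Ici (t + h))] B ∧
    r = |P.real (A ∩ B) - P.real A * P.real B|}

end

/-!
The time average of the triple `(λ(θ*), λ(θ), ∂_θ λ(θ))` is the time average of a continuous function
`g_θ` of the covariate process `X` (`intensityTriple_coxIntensity`), and for bounded `θ` the functions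
`g_θ` are dominated by a single exponential of `∑_j |x_j|`, so that all moments of `g_θ(X_0)` are finite
and bounded uniformly in `θ`. The theorem therefore reduces to a moment bound for a centred process
`Y_t = g(X_t) - E g(X_0)` that is strongly mixing at an exponential rate: with `S_t = ∫₀ᵗ Y`,
`E S_T^{2k} ≤ C T^k`, where `C` depends only on `k`, the mixing rate and a bound for `E Y^{4k}`
(`CentredMixingProcess.integral_pow_le`).

The moment bound avoids the usual combinatorics of the gaps between time points. Since `S` is
absolutely continuous, applying the fundamental theorem of calculus twice gives
`S_T^{2k} = 2k(2k-1) ∫₀ᵀ ∫₀ᵘ S_s^{2k-2} Y_s Y_u ds du`. In the expectation of the integrand, `Y_u` may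
be replaced by `W = E[Y_u | past of s]`. By mixing, `E |W|` is exponentially small in `u - s`, and the
conditional Jensen inequality bounds `E W^{4k}`; interpolation makes `E W^{2k}` exponentially small
(`integral_condExp_pow_le_of_mixing`). The weighted inequality
`s^{2k-2} z ≤ η s^{2k} + η^{1-k} z^k` then leads to
`E S_T^{2k} ≤ c T (η sup_{t ≤ T} E S_t^{2k} + η^{1-k} K)`, and the choice `η = 1 / (2cT)` absorbs half
of the supremum.

The integrals `S_t` must be measurable with respect to the past, and `Y` must be jointly measurable;
both follow from the left-continuity of the paths (`measurable_uncurry_of_leftContinuous`).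
-/

/-! ### Covariance estimates under strong mixing -/

/-- If the event `A` is almost independent of all superlevel sets of a bounded `f`, then it is almost
independent of `f`: integrate the estimate over the levels. -/
lemma abs_setIntegral_sub_le_of_superlevel {Ω : Type*} [MeasurableSpace Ω] {P : Measure Ω}
    [IsProbabilityMeasure P] {A : Set Ω} {f : Ω → ℝ} (hf : Measurable f)
    {M ε : ℝ} (hf0 : ∀ ω, 0 ≤ f ω) (hfM : ∀ ω, f ω ≤ M)
    (h : ∀ y : ℝ, |P.real (A ∩ {ω | y ≤ f ω}) - P.real A * P.real {ω | y ≤ f ω}| ≤ ε) :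
    |∫ ω in A, f ω ∂P - P.real A * ∫ ω, f ω ∂P| ≤ M * ε := by
  obtain ⟨ω₀⟩ : Nonempty Ω := nonempty_of_isProbabilityMeasure P
  have hM : 0 ≤ M := (hf0 ω₀).trans (hfM ω₀)
  have hint : ∀ (μ : Measure Ω) [IsFiniteMeasure μ], Integrable f μ := fun μ _ =>
    Integrable.of_bound hf.aestronglyMeasurable M
      (ae_of_all _ fun ω => by rw [Real.norm_of_nonneg (hf0 ω)]; exact hfM ω)
  have hlayer : ∀ (μ : Measure Ω) [IsFiniteMeasure μ],
      IntegrableOn (fun t : ℝ => μ.real {ω | t ≤ f ω}) (Set.Ioc 0 M) := fun μ _ => by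
    have hanti : Antitone fun t : ℝ => μ.real {ω | t ≤ f ω} := fun s t hst =>
      measureReal_mono fun ω (hω : t ≤ f ω) => hst.trans hω
    exact (intervalIntegrable_iff_integrableOn_Ioc_of_le hM).1 hanti.intervalIntegrable
  rw [(hint (P.restrict A)).integral_eq_integral_Ioc_meas_le (ae_of_all _ hf0) (ae_of_all _ hfM),
    (hint P).integral_eq_integral_Ioc_meas_le (ae_of_all _ hf0) (ae_of_all _ hfM),
    ← integral_const_mul, ← integral_sub (hlayer _) ((hlayer _).const_mul _)]
  have hle := norm_setIntegral_le_of_norm_le_const (μ := volume) (s := Set.Ioc 0 M) (C := ε)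
    (f := fun t => (P.restrict A).real {ω | t ≤ f ω} - P.real A * P.real {ω | t ≤ f ω})
    (by simp) (fun t _ => by
      rw [Real.norm_eq_abs, measureReal_restrict_apply (measurableSet_le measurable_const hf),
        Set.inter_comm]
      exact h t)
  simpa [hM, mul_comm] using hle

/-- Truncating `V` at level `v` costs `2 E V² / v`, and the bounded part is controlled by the
mixing bound. -/
lemma abs_setIntegral_le_of_mixing {Ω : Type*} [MeasurableSpace Ω] {P : Measure Ω}
    [IsProbabilityMeasure P] {A : Set Ω} {V : Ω → ℝ} (hV : Measurable V)
    (hV2 : Integrable (fun ω => V ω ^ 2) P) (hV0 : ∫ ω, V ω ∂P = 0) {ε v : ℝ} (hv : 0 < v)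
    (h : ∀ B : Set ℝ, MeasurableSet B →
      |P.real (A ∩ V ⁻¹' B) - P.real A * P.real (V ⁻¹' B)| ≤ ε) :
    |∫ ω in A, V ω ∂P| ≤ 2 * v * ε + 2 * ((∫ ω, V ω ^ 2 ∂P) / v) := by
  have hV1 : Integrable V P :=
    ((memLp_two_iff_integrable_sq hV.aestronglyMeasurable).2 hV2).integrable one_le_two
  -- the truncation of `V` to `[-v, v]`
  set U : Ω → ℝ := fun ω => max (-v) (min v (V ω)) with hU
  have hUm : Measurable U := measurable_const.max (measurable_const.min hV)
  have hUlo : ∀ ω, -v ≤ U ω := fun ω => le_max_left _ _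
  have hUhi : ∀ ω, U ω ≤ v := fun ω => max_le (by linarith) (min_le_left _ _)
  have hUint : Integrable U P := Integrable.of_bound hUm.aestronglyMeasurable v
    (ae_of_all _ fun ω => abs_le.2 ⟨hUlo ω, hUhi ω⟩)
  have hdiff : ∀ ω, |V ω - U ω| ≤ V ω ^ 2 / v := fun ω => by
    rw [le_div_iff₀ hv]
    simp only [hU]
    rcases le_total (V ω) v with h1 | h1
    · rcases le_total (-v) (V ω) with h2 | h2
      · rw [min_eq_right h1, max_eq_right h2]; simp; positivity
      · rw [min_eq_right h1, max_eq_left h2, abs_of_nonpos (by linarith)]; nlinarith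
    · rw [min_eq_left h1, max_eq_right (by linarith), abs_of_nonneg (by linarith)]; nlinarith
  have hbound : ∀ s : Set Ω, |∫ ω in s, (V ω - U ω) ∂P| ≤ (∫ ω, V ω ^ 2 ∂P) / v := fun s => by
    rw [← integral_div]
    calc |∫ ω in s, (V ω - U ω) ∂P| ≤ ∫ ω in s, |V ω - U ω| ∂P := abs_integral_le_integral_abs
      _ ≤ ∫ ω, |V ω - U ω| ∂P :=
        setIntegral_le_integral (hV1.sub hUint).abs (ae_of_all _ fun ω => abs_nonneg _)
      _ ≤ _ := integral_mono (hV1.sub hUint).abs (hV2.div_const v) hdiff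
  have hlay := abs_setIntegral_sub_le_of_superlevel (P := P) (A := A) (f := fun ω => U ω + v)
    (M := 2 * v) (ε := ε) (hUm.add_const v) (fun ω => by linarith [hUlo ω])
    (fun ω => by linarith [hUhi ω]) (fun y => by
      have : MeasurableSet {x : ℝ | y ≤ max (-v) (min v x) + v} :=
        measurableSet_le measurable_const (by fun_prop)
      exact h _ this)
  rw [integral_add hUint.integrableOn (integrable_const v), integral_add hUint (integrable_const v)]
    at hlay
  simp only [integral_const, smul_eq_mul, measureReal_restrict_apply_univ, probReal_univ,
    one_mul] at hlay
  have h1 := hbound A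
  have h2 := hbound Set.univ
  rw [integral_sub hV1.integrableOn hUint.integrableOn] at h1
  rw [Measure.restrict_univ, integral_sub hV1 hUint, hV0] at h2
  have hP1 : P.real A ≤ 1 := measureReal_le_one
  have hP0 : 0 ≤ P.real A := measureReal_nonneg
  have h3 : |P.real A * ∫ ω, U ω ∂P| ≤ (∫ ω, V ω ^ 2 ∂P) / v := by
    rw [abs_mul, abs_of_nonneg hP0]
    rw [zero_sub, abs_neg] at h2
    exact (mul_le_of_le_one_left (abs_nonneg _) hP1).trans h2
  rw [abs_le] at *
  constructor <;> nlinarith [h1.1, h1.2, h3.1, h3.2, hlay.1, hlay.2]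

/-- Interpolation: an `L¹` bound on the conditional expectation `E[V | m]` of a centred variable
that is almost independent of `m`, combined with the conditional Jensen inequality for the `4k`-th
power, gives a small `2k`-th moment. -/
lemma integral_condExp_pow_le_of_mixing {Ω : Type*} {m mΩ : MeasurableSpace Ω} {P : Measure Ω}
    [IsProbabilityMeasure P] (hm : m ≤ mΩ) {k : ℕ} (hk : 1 ≤ k) {V : Ω → ℝ} (hV : Measurable V)
    (hVk : Integrable (fun ω => V ω ^ (4 * k)) P) (hV2 : Integrable (fun ω => V ω ^ 2) P)
    (hV0 : ∫ ω, V ω ∂P = 0) {b w : ℝ} (hb : 0 < b) (hw : 0 < w)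
    (hw1 : w ≤ 1)
    (h : ∀ A : Set Ω, MeasurableSet[m] A → ∀ B : Set ℝ, MeasurableSet B →
      |P.real (A ∩ V ⁻¹' B) - P.real A * P.real (V ⁻¹' B)| ≤ (b * w ^ (4 * k)) ^ 2) :
    Integrable (fun ω => (P[V | m]) ω ^ (2 * k)) P ∧
    ∫ ω, (P[V | m]) ω ^ (2 * k) ∂P ≤
      w ^ (2 * k) * (4 * b * (1 + ∫ ω, V ω ^ 2 ∂P) + ∫ ω, V ω ^ (4 * k) ∂P) := by
  have hV1 : Integrable V P :=
    ((memLp_two_iff_integrable_sq hV.aestronglyMeasurable).2 hV2).integrable one_le_two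
  set W := P[V | m] with hW
  have hWm : StronglyMeasurable[m] W := stronglyMeasurable_condExp
  have hWm' : Measurable W := (hWm.mono hm).measurable
  have hW1 : Integrable W P := integrable_condExp
  have hev : Even (4 * k) := ⟨2 * k, by ring⟩
  have hev2 : Even (2 * k) := even_two_mul k
  -- the conditional Jensen inequality for `x ↦ x ^ (4 * k)`
  have hjen : (fun ω => W ω ^ (4 * k)) ≤ᵐ[P] P[fun ω => V ω ^ (4 * k) | m] :=
    ConvexOn.map_condExp_le_univ (φ := fun x : ℝ => x ^ (4 * k)) hm hev.convexOn_pow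
      (continuous_pow _).lowerSemicontinuous hV1 hVk
  have hW4 : Integrable (fun ω => W ω ^ (4 * k)) P := by
    refine Integrable.mono' (integrable_condExp (f := fun ω => V ω ^ (4 * k)) (m := m) (μ := P))
      (hWm'.pow_const _).aestronglyMeasurable ?_
    filter_upwards [hjen] with ω hω
    rwa [Real.norm_of_nonneg (hev.pow_nonneg _)]
  have hW4le : ∫ ω, W ω ^ (4 * k) ∂P ≤ ∫ ω, V ω ^ (4 * k) ∂P := by
    rw [← integral_condExp hm (f := fun ω => V ω ^ (4 * k))]
    exact integral_mono_ae hW4 integrable_condExp hjen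
  -- the `L¹` bound, from the event on which the conditional expectation is nonnegative
  set A : Set Ω := {ω | 0 ≤ W ω} with hA
  have hAm : MeasurableSet[m] A := measurableSet_le (@measurable_const _ _ _ m 0) hWm.measurable
  have hβ : 0 < b * w ^ (4 * k) := by positivity
  have hW0 : ∫ ω, W ω ∂P = 0 := by rw [hW, integral_condExp hm, hV0]
  have hWabs : ∫ ω, |W ω| ∂P ≤ 4 * (b * w ^ (4 * k)) * (1 + ∫ ω, V ω ^ 2 ∂P) := by
    have h1 : ∫ ω in A, W ω ∂P = ∫ ω in A, V ω ∂P := setIntegral_condExp hm hV1 hAm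
    have h2 : ∫ ω, |W ω| ∂P = 2 * ∫ ω in A, V ω ∂P := by
      have e : ∀ ω, |W ω| = 2 * A.indicator W ω - W ω := fun ω => by
        by_cases hω : 0 ≤ W ω
        · rw [Set.indicator_of_mem (show ω ∈ A from hω), abs_of_nonneg hω]; ring
        · rw [Set.indicator_of_notMem (show ω ∉ A from hω), abs_of_neg (not_le.1 hω)]; ring
      simp_rw [e]
      rw [integral_sub ((hW1.indicator (hm _ hAm)).const_mul 2) hW1, hW0, integral_const_mul,
        integral_indicator (hm _ hAm), h1, sub_zero]
    -- the truncation level `v = (b w^(4k))⁻¹` balances the two error terms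
    have h3 := abs_setIntegral_le_of_mixing hV hV2 hV0 (A := A) (v := (b * w ^ (4 * k))⁻¹)
      (inv_pos.2 hβ) (h A hAm)
    have h4 : 2 * (b * w ^ (4 * k))⁻¹ * (b * w ^ (4 * k)) ^ 2
        + 2 * ((∫ ω, V ω ^ 2 ∂P) / (b * w ^ (4 * k))⁻¹)
        = 2 * (b * w ^ (4 * k)) * (1 + ∫ ω, V ω ^ 2 ∂P) := by
      field_simp
    rw [h4] at h3
    rw [h2]
    linarith [le_abs_self (∫ ω in A, V ω ∂P)]
  -- interpolation between the powers `1` and `4k`, splitting at the level `|x| = w⁻¹`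
  have hpt : ∀ x : ℝ, x ^ (2 * k) ≤ w⁻¹ ^ (2 * k - 1) * |x| + w ^ (2 * k) * x ^ (4 * k) := by
    intro x
    have hx : x ^ (2 * k) = |x| ^ (2 * k) := (hev2.pow_abs x).symm
    have hx4 : x ^ (4 * k) = |x| ^ (4 * k) := (hev.pow_abs x).symm
    rw [hx, hx4]
    have h0 := abs_nonneg x
    rcases le_total |x| w⁻¹ with h1 | h1
    · have : |x| ^ (2 * k) = |x| ^ (2 * k - 1) * |x| := by
        rw [← pow_succ]; congr 1; omega
      rw [this]
      have := pow_le_pow_left₀ h0 h1 (2 * k - 1)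
      have h5 : 0 ≤ w ^ (2 * k) * |x| ^ (4 * k) := by positivity
      nlinarith
    · have h2 : 1 ≤ w * |x| := by
        rwa [inv_le_iff_one_le_mul₀' hw] at h1
      have h3 : 1 ≤ (w * |x|) ^ (2 * k) := one_le_pow₀ h2
      have h4 : w ^ (2 * k) * |x| ^ (4 * k) = (w * |x|) ^ (2 * k) * |x| ^ (2 * k) := by
        rw [mul_pow, mul_assoc, ← pow_add]; congr 2; omega
      rw [h4]
      have h5 : 0 ≤ w⁻¹ ^ (2 * k - 1) * |x| := by positivity
      have h6 : 0 ≤ |x| ^ (2 * k) := by positivity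
      nlinarith
  have hdom : Integrable (fun ω => w⁻¹ ^ (2 * k - 1) * |W ω| + w ^ (2 * k) * W ω ^ (4 * k)) P :=
    (hW1.abs.const_mul _).add (hW4.const_mul _)
  have hint : Integrable (fun ω => W ω ^ (2 * k)) P := by
    refine Integrable.mono' hdom (hWm'.pow_const _).aestronglyMeasurable (ae_of_all _ fun ω => ?_)
    rw [Real.norm_of_nonneg (hev2.pow_nonneg _)]
    exact hpt _
  refine ⟨hint, (integral_mono hint hdom fun ω => hpt _).trans ?_⟩
  rw [integral_add (hW1.abs.const_mul _) (hW4.const_mul _), integral_const_mul, integral_const_mul]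
  have h7 : w⁻¹ ^ (2 * k - 1) * (4 * (b * w ^ (4 * k)) * (1 + ∫ ω, V ω ^ 2 ∂P))
      = w * w ^ (2 * k) * (4 * b * (1 + ∫ ω, V ω ^ 2 ∂P)) := by
    have : w ^ (4 * k) = w ^ (2 * k - 1) * (w * w ^ (2 * k)) := by
      rw [← pow_succ', ← pow_add]; congr 1; omega
    rw [this, inv_pow]; field_simp
  have hV2nn : 0 ≤ ∫ ω, V ω ^ 2 ∂P := integral_nonneg fun ω => sq_nonneg _
  calc _ ≤ w⁻¹ ^ (2 * k - 1) * (4 * (b * w ^ (4 * k)) * (1 + ∫ ω, V ω ^ 2 ∂P))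
        + w ^ (2 * k) * ∫ ω, V ω ^ (4 * k) ∂P := by gcongr
    _ = w * (w ^ (2 * k) * (4 * b * (1 + ∫ ω, V ω ^ 2 ∂P)))
        + w ^ (2 * k) * ∫ ω, V ω ^ (4 * k) ∂P := by rw [h7]; ring
    _ ≤ 1 * (w ^ (2 * k) * (4 * b * (1 + ∫ ω, V ω ^ 2 ∂P)))
        + w ^ (2 * k) * ∫ ω, V ω ^ (4 * k) ∂P := by gcongr
    _ = _ := by ring

/-- A weighted form of Young's inequality: either `z ≤ η s²`, or `s² < z / η`. -/
lemma pow_mul_le_weighted {k : ℕ} (hk : 1 ≤ k) (s : ℝ) {z η : ℝ} (hz : 0 ≤ z) (hη : 0 < η) :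
    s ^ (2 * k - 2) * z ≤ η * s ^ (2 * k) + η⁻¹ ^ (k - 1) * z ^ k := by
  obtain ⟨n, rfl⟩ : ∃ n, k = n + 1 := ⟨k - 1, by omega⟩
  have e1 : 2 * (n + 1) - 2 = 2 * n := by omega
  rw [e1, Nat.add_sub_cancel, pow_mul, pow_mul, pow_succ (s ^ 2), pow_succ z, ← mul_assoc,
    ← mul_assoc]
  have hs := sq_nonneg s
  rcases le_total z (η * s ^ 2) with h | h
  · have h1 : 0 ≤ η⁻¹ ^ n * z ^ n * z := by positivity
    have h2 : 0 ≤ (s ^ 2) ^ n := by positivity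
    nlinarith
  · have h1 : s ^ 2 ≤ η⁻¹ * z := by rwa [inv_mul_eq_div, le_div_iff₀' hη]
    have h2 := pow_le_pow_left₀ hs h1 n
    rw [mul_pow] at h2
    have h3 : 0 ≤ η * (s ^ 2) ^ n * s ^ 2 := by positivity
    nlinarith

lemma abs_pow_mul_mul_le {k : ℕ} (hk : 1 ≤ k) (s y z : ℝ) :
    |s ^ (2 * k - 2) * y * z| ≤ s ^ (2 * k) + y ^ (2 * k) + z ^ (2 * k) := by
  have hev : Even (2 * k) := even_two_mul k
  have h1 := pow_mul_le_weighted hk s (mul_nonneg (abs_nonneg y) (abs_nonneg z)) one_pos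
  have h2 : (|y| * |z|) ^ k ≤ y ^ (2 * k) + z ^ (2 * k) := by
    rw [mul_pow, ← hev.pow_abs y, ← hev.pow_abs z, mul_comm 2 k, pow_mul, pow_mul]
    nlinarith [sq_nonneg (|y| ^ k - |z| ^ k), sq_nonneg (|y| ^ k + |z| ^ k)]
  have hev3 : Even (2 * k - 2) := ⟨k - 1, by omega⟩
  rw [abs_mul, abs_mul, abs_of_nonneg (hev3.pow_nonneg s), mul_assoc]
  simp only [inv_one, one_pow, one_mul] at h1
  linarith

/-- The covariance estimate that drives the moment bound: `S` and `Y` belong to the past `m`, and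
the centred `V` is almost independent of it, at rate `(b w^(4k))²`. The weight `η` is
free. -/
lemma abs_integral_pow_mul_mul_le_of_mixing {Ω : Type*} {m mΩ : MeasurableSpace Ω}
    {P : Measure Ω} [IsProbabilityMeasure P] (hm : m ≤ mΩ) {k : ℕ} (hk : 1 ≤ k) {S Y V : Ω → ℝ}
    (hS : StronglyMeasurable[m] S) (hY : StronglyMeasurable[m] Y) (hV : Measurable V)
    (hSk : Integrable (fun ω => S ω ^ (2 * k)) P) (hYk : Integrable (fun ω => Y ω ^ (2 * k)) P)
    (hVk : Integrable (fun ω => V ω ^ (4 * k)) P) (hV2k : Integrable (fun ω => V ω ^ (2 * k)) P)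
    (hV2 : Integrable (fun ω => V ω ^ 2) P)
    (hV0 : ∫ ω, V ω ∂P = 0) {b w η : ℝ} (hb : 0 < b) (hw : 0 < w) (hw1 : w ≤ 1) (hη : 0 < η)
    (h : ∀ A : Set Ω, MeasurableSet[m] A → ∀ B : Set ℝ, MeasurableSet B →
      |P.real (A ∩ V ⁻¹' B) - P.real A * P.real (V ⁻¹' B)| ≤ (b * w ^ (4 * k)) ^ 2) :
    |∫ ω, S ω ^ (2 * k - 2) * Y ω * V ω ∂P| ≤
      w * (η * ∫ ω, S ω ^ (2 * k) ∂P + η⁻¹ ^ (k - 1) * (∫ ω, Y ω ^ (2 * k) ∂P +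
        (4 * b * (1 + ∫ ω, V ω ^ 2 ∂P) + ∫ ω, V ω ^ (4 * k) ∂P))) := by
  have hV1 : Integrable V P :=
    ((memLp_two_iff_integrable_sq hV.aestronglyMeasurable).2 hV2).integrable one_le_two
  obtain ⟨hWint, hWle⟩ := integral_condExp_pow_le_of_mixing hm hk hV hVk hV2 hV0 hb hw hw1 h
  set W := P[V | m] with hW
  have hWm : StronglyMeasurable[m] W := stronglyMeasurable_condExp
  have hUm : StronglyMeasurable[m] (fun ω => S ω ^ (2 * k - 2) * Y ω) := (hS.pow _).mul hY
  have hdom : ∀ {Z : Ω → ℝ}, Measurable Z → Integrable (fun ω => Z ω ^ (2 * k)) P →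
      Integrable (fun ω => S ω ^ (2 * k - 2) * Y ω * Z ω) P := fun {Z} hZ hZk =>
    Integrable.mono' ((hSk.add hYk).add hZk)
      ((hUm.mono hm).measurable.mul hZ).aestronglyMeasurable
      (ae_of_all _ fun ω => abs_pow_mul_mul_le hk _ _ _)
  -- only the conditional expectation of `V` given the past matters
  have hpull : ∫ ω, S ω ^ (2 * k - 2) * Y ω * V ω ∂P
      = ∫ ω, S ω ^ (2 * k - 2) * Y ω * W ω ∂P := by
    rw [← integral_condExp hm]
    exact integral_congr_ae (condExp_mul_of_stronglyMeasurable_left hUm (hdom hV hV2k) hV1)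
  have hev : Even (2 * k) := even_two_mul k
  have hpt : ∀ ω, |S ω ^ (2 * k - 2) * Y ω * W ω| ≤
      w * (η * S ω ^ (2 * k) + η⁻¹ ^ (k - 1) * (Y ω ^ (2 * k) + (w ^ (2 * k))⁻¹ * W ω ^ (2 * k))) := by
    intro ω
    have h1 := pow_mul_le_weighted hk (S ω) (z := |Y ω| * (w⁻¹ * |W ω|)) (by positivity) hη
    have h2 : (|Y ω| * (w⁻¹ * |W ω|)) ^ k ≤ Y ω ^ (2 * k) + (w ^ (2 * k))⁻¹ * W ω ^ (2 * k) := by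
      rw [← inv_pow, ← mul_pow, mul_pow |Y ω|, ← hev.pow_abs (Y ω), ← hev.pow_abs (w⁻¹ * W ω),
        abs_mul, abs_of_pos (inv_pos.2 hw), mul_comm 2 k, pow_mul, pow_mul]
      nlinarith [sq_nonneg (|Y ω| ^ k - (w⁻¹ * |W ω|) ^ k),
        sq_nonneg (|Y ω| ^ k + (w⁻¹ * |W ω|) ^ k)]
    have hev3 : Even (2 * k - 2) := ⟨k - 1, by omega⟩
    have h3 : |S ω ^ (2 * k - 2) * Y ω * W ω|
        = w * (S ω ^ (2 * k - 2) * (|Y ω| * (w⁻¹ * |W ω|))) := by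
      rw [abs_mul, abs_mul, abs_of_nonneg (hev3.pow_nonneg _)]; field_simp
    rw [h3]
    gcongr
    refine h1.trans ?_
    gcongr
  have hYW : Integrable (fun ω => Y ω ^ (2 * k) + (w ^ (2 * k))⁻¹ * W ω ^ (2 * k)) P :=
    hYk.add (hWint.const_mul _)
  have hint2 : Integrable (fun ω => w * (η * S ω ^ (2 * k) + η⁻¹ ^ (k - 1) *
      (Y ω ^ (2 * k) + (w ^ (2 * k))⁻¹ * W ω ^ (2 * k)))) P :=
    ((hSk.const_mul _).add (hYW.const_mul _)).const_mul _
  rw [hpull]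
  refine abs_integral_le_integral_abs.trans ((integral_mono
    (hdom (hWm.mono hm).measurable hWint).abs hint2 hpt).trans ?_)
  rw [integral_const_mul, integral_add (hSk.const_mul _) (hYW.const_mul _),
    integral_const_mul, integral_const_mul, integral_add hYk (hWint.const_mul _),
    integral_const_mul]
  gcongr
  rwa [inv_mul_le_iff₀ (by positivity)]

/-! ### Powers of an indefinite integral -/

/-- The indefinite integral is only absolutely continuous, so this is the fundamental theorem of
calculus for absolutely continuous functions. -/
lemma intervalIntegral_pow_succ {y : ℝ → ℝ} {T : ℝ} (hy : IntervalIntegrable y volume 0 T) (n : ℕ) :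
    (∫ s in (0 : ℝ)..T, y s) ^ (n + 1)
      = (n + 1) * ∫ t in (0 : ℝ)..T, y t * (∫ s in (0 : ℝ)..t, y s) ^ n := by
  set S : ℝ → ℝ := fun t => ∫ s in (0 : ℝ)..t, y s with hS
  have hac : AbsolutelyContinuousOnInterval S 0 T :=
    hy.absolutelyContinuousOnInterval_intervalIntegral Set.left_mem_uIcc
  have hpow : ∀ n : ℕ, AbsolutelyContinuousOnInterval (fun t => S t ^ (n + 1)) 0 T := by
    intro n
    induction n with
    | zero => simpa using hac
    | succ n ih => simpa only [pow_succ _ (n + 1)] using ih.fun_mul hac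
  have hftc := (hpow n).integral_deriv_eq_sub
  have hS0 : S 0 = 0 := by simp [hS]
  rw [hS0, zero_pow (Nat.succ_ne_zero n), sub_zero] at hftc
  change S T ^ (n + 1) = _
  rw [← hftc, ← intervalIntegral.integral_const_mul]
  refine intervalIntegral.integral_congr_ae ?_
  filter_upwards [hy.ae_hasDerivAt_integral] with t ht htT
  have hd : HasDerivAt S (y t) t := ht (Set.uIoc_subset_uIcc htT) 0 Set.left_mem_uIcc
  rw [(hd.fun_pow (n + 1)).deriv]
  push_cast
  ring

/-- Applying `intervalIntegral_pow_succ` twice isolates the values of `y` at the two latest times. -/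
lemma intervalIntegral_pow_eq_iterated {y : ℝ → ℝ} {T : ℝ} (hT : 0 ≤ T)
    (hy : IntervalIntegrable y volume 0 T) {k : ℕ} (hk : 1 ≤ k) :
    (∫ s in (0 : ℝ)..T, y s) ^ (2 * k) = (2 * k * (2 * k - 1) : ℝ) *
      ∫ u in Set.Ioc 0 T, ∫ s in Set.Ioc 0 T,
        if s < u then (∫ r in (0 : ℝ)..s, y r) ^ (2 * k - 2) * y s * y u else 0 := by
  obtain ⟨n, rfl⟩ : ∃ n, k = n + 1 := ⟨k - 1, by omega⟩
  have e1 : 2 * (n + 1) = (2 * n + 1) + 1 := by ring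
  have e2 : 2 * (n + 1) - 2 = 2 * n := by omega
  rw [e2, e1, intervalIntegral_pow_succ hy, intervalIntegral.integral_of_le hT]
  have hinner : ∀ u ∈ Set.Ioc 0 T, y u * (∫ s in (0 : ℝ)..u, y s) ^ (2 * n + 1)
      = (2 * n + 1 : ℝ) * ∫ s in Set.Ioc 0 T,
        if s < u then (∫ r in (0 : ℝ)..s, y r) ^ (2 * n) * y s * y u else 0 := by
    intro u hu
    have hyu : IntervalIntegrable y volume 0 u :=
      hy.mono_set (by rw [Set.uIcc_of_le hT, Set.uIcc_of_le hu.1.le]; exact Set.Icc_subset_Icc_right hu.2)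
    rw [intervalIntegral_pow_succ hyu, intervalIntegral.integral_of_le hu.1.le,
      integral_Ioc_eq_integral_Ioo]
    have hset : Set.Ioo 0 u = Set.Ioc 0 T ∩ Set.Iio u := by
      ext s; simp only [Set.mem_Ioo, Set.mem_inter_iff, Set.mem_Ioc, Set.mem_Iio]
      exact ⟨fun h => ⟨⟨h.1, h.2.le.trans hu.2⟩, h.2⟩, fun h => ⟨h.1.1, h.2⟩⟩
    rw [hset, ← setIntegral_indicator measurableSet_Iio, mul_left_comm, ← integral_const_mul]
    push_cast
    congr 1
    refine integral_congr_ae (ae_of_all _ fun s => ?_)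
    by_cases hs : s < u
    · simp only [Set.indicator, Set.mem_Iio, hs, if_true]; ring
    · simp [Set.indicator, hs]
  rw [setIntegral_congr_fun measurableSet_Ioc hinner, integral_const_mul]
  push_cast
  ring

/-! ### The moment bound for time integrals of exponentially mixing processes -/

/-- A centred, jointly measurable process `Y` on the half-line whose `4k`-th moments are bounded by
`M`, and whose future values decouple from its past `𝓕` at the exponential rate `a⁻¹ e^{-ah}`.
The time index is `ℝ`, so that interval integrals apply; the bounds at negative
times are redundant (the process is constant there in the application). The past is a family of
`σ`-fields that make `Y` and its indefinite integral adapted. -/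
structure CentredMixingProcess {Ω : Type*} [mΩ : MeasurableSpace Ω] (P : Measure Ω)
    (Y : ℝ → Ω → ℝ) (𝓕 : ℝ → MeasurableSpace Ω) (k : ℕ) (a M : ℝ) : Prop where
  measurable : Measurable (Function.uncurry Y)
  past_le : ∀ s, 𝓕 s ≤ mΩ
  adapted : ∀ s, StronglyMeasurable[𝓕 s] (Y s)
  adapted_integral : ∀ s, 0 ≤ s → StronglyMeasurable[𝓕 s] (fun ω => ∫ u in (0 : ℝ)..s, Y u ω)
  centred : ∀ s, ∫ ω, Y s ω ∂P = 0
  integrable : ∀ s, Integrable (fun ω => Y s ω ^ (4 * k)) P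
  moment_le : ∀ s, ∫ ω, Y s ω ^ (4 * k) ∂P ≤ M
  mixing : ∀ s t, 0 ≤ s → s < t → ∀ A, MeasurableSet[𝓕 s] A → ∀ B : Set ℝ, MeasurableSet B →
    |P.real (A ∩ Y t ⁻¹' B) - P.real A * P.real (Y t ⁻¹' B)| ≤ a⁻¹ * Real.exp (-a * (t - s))

/-- Jensen's inequality on `(0, T]`. -/
lemma setIntegral_abs_pow_le {y : ℝ → ℝ} {T : ℝ} (hT : 0 < T) {n : ℕ}
    (hy : IntegrableOn y (Set.Ioc 0 T)) (hyn : IntegrableOn (fun s => |y s| ^ n) (Set.Ioc 0 T)) :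
    (∫ s in Set.Ioc 0 T, |y s|) ^ n ≤ T ^ n * T⁻¹ * ∫ s in Set.Ioc 0 T, |y s| ^ n := by
  have : NeZero (volume.restrict (Set.Ioc 0 T)) := ⟨by
    rw [Ne, Measure.restrict_eq_zero, Real.volume_Ioc]; simp [hT]⟩
  have hJ := (convexOn_pow (𝕜 := ℝ) n).map_average_le (μ := volume.restrict (Set.Ioc 0 T))
    (f := fun s => |y s|) (continuous_pow n).continuousOn isClosed_Ici
    (ae_of_all _ fun s => Set.mem_Ici.2 (abs_nonneg _)) hy.abs hyn
  simp only [average_eq, measureReal_restrict_apply_univ, Real.volume_real_Ioc_of_le hT.le,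
    sub_zero, smul_eq_mul, mul_pow] at hJ
  calc (∫ s in Set.Ioc 0 T, |y s|) ^ n
      = T ^ n * (T⁻¹ ^ n * (∫ s in Set.Ioc 0 T, |y s|) ^ n) := by
        rw [← mul_assoc, ← mul_pow, mul_inv_cancel₀ hT.ne', one_pow, one_mul]
    _ ≤ T ^ n * (T⁻¹ * ∫ s in Set.Ioc 0 T, |y s| ^ n) := by gcongr
    _ = _ := by ring

/-- A jointly measurable process with bounded `n`-th moments is almost surely integrable on bounded
time intervals, and so is the `n`-th power of the integral of its absolute value. -/
lemma integrable_pow_integral_abs {Ω : Type*} [MeasurableSpace Ω] {P : Measure Ω}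
    [IsProbabilityMeasure P] {Y : ℝ → Ω → ℝ} (hY : Measurable (Function.uncurry Y)) {n : ℕ}
    (hn : 1 ≤ n) {M : ℝ} (hint : ∀ s, Integrable (fun ω => |Y s ω| ^ n) P)
    (hM : ∀ s, ∫ ω, |Y s ω| ^ n ∂P ≤ M) {T : ℝ} (hT : 0 < T) :
    (∀ᵐ ω ∂P, IntegrableOn (fun s => Y s ω) (Set.Ioc 0 T)) ∧
    Integrable (fun ω => (∫ s in Set.Ioc 0 T, |Y s ω|) ^ n) P := by
  have hYn : Measurable (fun p : ℝ × Ω => |Y p.1 p.2| ^ n) := hY.abs.pow_const n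
  have hprod : Integrable (fun p : ℝ × Ω => |Y p.1 p.2| ^ n)
      ((volume.restrict (Set.Ioc 0 T)).prod P) := by
    refine (integrable_prod_iff hYn.aestronglyMeasurable).2 ⟨ae_of_all _ fun s => hint s, ?_⟩
    refine Integrable.of_bound (hYn.norm.stronglyMeasurable.integral_prod_right).aestronglyMeasurable
      M (ae_of_all _ fun s => ?_)
    rw [Real.norm_of_nonneg (integral_nonneg fun ω => norm_nonneg _)]
    simpa using hM s
  have hae : ∀ᵐ ω ∂P, IntegrableOn (fun s => Y s ω) (Set.Ioc 0 T) ∧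
      IntegrableOn (fun s => |Y s ω| ^ n) (Set.Ioc 0 T) := by
    filter_upwards [hprod.prod_left_ae] with ω hω
    refine ⟨Integrable.mono' (hω.add (integrable_const 1))
      (hY.comp measurable_prodMk_right).aestronglyMeasurable (ae_of_all _ fun s => ?_), hω⟩
    rw [Real.norm_eq_abs]
    change |Y s ω| ≤ |Y s ω| ^ n + 1
    rcases le_total |Y s ω| 1 with h | h
    · have : 0 ≤ |Y s ω| ^ n := by positivity
      linarith
    · linarith [le_self_pow₀ h (by omega : n ≠ 0)]
  refine ⟨hae.mono fun ω h => h.1, ?_⟩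
  have hm : Measurable (fun ω => ∫ s in Set.Ioc 0 T, |Y s ω|) :=
    (hY.abs.stronglyMeasurable.integral_prod_left').measurable
  refine Integrable.mono' (hprod.integral_prod_right.const_mul (T ^ n * T⁻¹))
    (hm.pow_const n).aestronglyMeasurable ?_
  filter_upwards [hae] with ω hω
  rw [Real.norm_of_nonneg (pow_nonneg (integral_nonneg fun s => abs_nonneg _) n)]
  exact setIntegral_abs_pow_le hT hω.1 hω.2

lemma setIntegral_exp_kernel_le {r T u : ℝ} (hr : 0 < r) (hu : u ∈ Set.Ioc 0 T) :
    ∫ s in Set.Ioc 0 T, (if s < u then Real.exp (-r * (u - s)) else 0) ≤ r⁻¹ := by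
  have hset : Set.Ioc 0 T ∩ Set.Iio u = Set.Ioo 0 u := by
    ext s; simp only [Set.mem_Ioo, Set.mem_inter_iff, Set.mem_Ioc, Set.mem_Iio]
    exact ⟨fun h => ⟨h.1.1, h.2⟩, fun h => ⟨⟨h.1, h.2.le.trans hu.2⟩, h.2⟩⟩
  have h1 : ∫ s in Set.Ioc 0 T, (if s < u then Real.exp (-r * (u - s)) else 0)
      = ∫ s in (0 : ℝ)..u, Real.exp (-r * u + r * s) := by
    rw [intervalIntegral.integral_of_le hu.1.le,
      show ∫ s in Set.Ioc 0 u, Real.exp (-r * u + r * s) = ∫ s in Set.Ioo 0 u, _ from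
        integral_Ioc_eq_integral_Ioo, ← hset,
      ← setIntegral_indicator measurableSet_Iio]
    refine integral_congr_ae (ae_of_all _ fun s => ?_)
    simp only [Set.indicator, Set.mem_Iio]
    congr 2; ring
  rw [h1]
  have h2 : ∀ s ∈ Set.uIcc 0 u,
      HasDerivAt (fun s => r⁻¹ * Real.exp (-r * u + r * s)) (Real.exp (-r * u + r * s)) s := by
    intro s _
    refine (((((hasDerivAt_id s).const_mul r).const_add (-r * u)).exp).const_mul r⁻¹).congr_deriv ?_
    simp only [id]
    field_simp
  rw [intervalIntegral.integral_eq_sub_of_hasDerivAt h2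
    (by apply Continuous.intervalIntegrable; fun_prop)]
  have h3 : -r * u + r * u = 0 := by ring
  rw [h3, Real.exp_zero, mul_one]
  have : 0 ≤ r⁻¹ * Real.exp (-r * u + r * 0) := by positivity
  linarith

namespace CentredMixingProcess

variable {Ω : Type*} [mΩ : MeasurableSpace Ω] {P : Measure Ω} [IsProbabilityMeasure P]
  {Y : ℝ → Ω → ℝ} {𝓕 : ℝ → MeasurableSpace Ω} {k : ℕ} {a M : ℝ}

lemma lower_moment (h : CentredMixingProcess P Y 𝓕 k a M) {n : ℕ} (hn : Even n) (hnk : n ≤ 4 * k)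
    (s : ℝ) : Integrable (fun ω => Y s ω ^ n) P ∧ ∫ ω, Y s ω ^ n ∂P ≤ 1 + M := by
  have hev : Even (4 * k) := ⟨2 * k, by ring⟩
  have hpt : ∀ x : ℝ, x ^ n ≤ 1 + x ^ (4 * k) := fun x => by
    rw [← hn.pow_abs, ← hev.pow_abs]
    rcases le_total |x| 1 with h1 | h1
    · have := pow_le_one₀ (n := n) (abs_nonneg x) h1
      have : 0 ≤ |x| ^ (4 * k) := by positivity
      linarith
    · linarith [pow_le_pow_right₀ h1 hnk]
  have hm : Measurable (Y s) := h.measurable.comp measurable_prodMk_left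
  have hdom : Integrable (fun ω => 1 + Y s ω ^ (4 * k)) P :=
    (integrable_const 1).add (h.integrable s)
  have hint : Integrable (fun ω => Y s ω ^ n) P :=
    Integrable.mono' hdom (hm.pow_const n).aestronglyMeasurable
      (ae_of_all _ fun ω => by rw [Real.norm_of_nonneg (hn.pow_nonneg _)]; exact hpt _)
  refine ⟨hint, (integral_mono hint hdom fun ω => hpt _).trans ?_⟩
  rw [integral_add (integrable_const 1) (h.integrable s)]
  simpa using h.moment_le s

lemma integral_abs_pow (h : CentredMixingProcess P Y 𝓕 k a M) (hk : 1 ≤ k) {T : ℝ} (hT : 0 < T) :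
    (∀ᵐ ω ∂P, IntegrableOn (fun s => Y s ω) (Set.Ioc 0 T)) ∧
    Integrable (fun ω => (∫ s in Set.Ioc 0 T, |Y s ω|) ^ (2 * k)) P := by
  have hev : Even (2 * k) := even_two_mul k
  refine integrable_pow_integral_abs h.measurable (by omega) (M := 1 + M) (fun s => ?_)
    (fun s => ?_) hT
  · simpa only [hev.pow_abs] using (h.lower_moment hev (by omega) s).1
  · simpa only [hev.pow_abs] using (h.lower_moment hev (by omega) s).2

lemma integral_pow (h : CentredMixingProcess P Y 𝓕 k a M) (hk : 1 ≤ k) {T s : ℝ} (hs : 0 < s)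
    (hsT : s ≤ T) :
    Integrable (fun ω => (∫ u in (0 : ℝ)..s, Y u ω) ^ (2 * k)) P ∧
    ∫ ω, (∫ u in (0 : ℝ)..s, Y u ω) ^ (2 * k) ∂P
      ≤ ∫ ω, (∫ u in Set.Ioc 0 T, |Y u ω|) ^ (2 * k) ∂P := by
  obtain ⟨hae, hR⟩ := h.integral_abs_pow hk (hs.trans_le hsT)
  have hev : Even (2 * k) := even_two_mul k
  have hle : ∀ᵐ ω ∂P, (∫ u in (0 : ℝ)..s, Y u ω) ^ (2 * k)
      ≤ (∫ u in Set.Ioc 0 T, |Y u ω|) ^ (2 * k) := by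
    filter_upwards [hae] with ω hω
    rw [← hev.pow_abs]
    refine pow_le_pow_left₀ (abs_nonneg _) ?_ _
    rw [intervalIntegral.integral_of_le hs.le]
    exact abs_integral_le_integral_abs.trans (setIntegral_mono_set hω.abs
      (ae_of_all _ fun u => abs_nonneg _) (Set.Ioc_subset_Ioc_right hsT).eventuallyLE)
  have hm := ((h.adapted_integral s hs.le).mono (h.past_le s)).pow (2 * k)
  have hint : Integrable (fun ω => (∫ u in (0 : ℝ)..s, Y u ω) ^ (2 * k)) P := by
    refine Integrable.mono' hR hm.aestronglyMeasurable ?_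
    filter_upwards [hle] with ω hω
    rwa [Real.norm_of_nonneg (hev.pow_nonneg _)]
  exact ⟨hint, integral_mono_ae hint hR hle⟩

/-- The covariance bound at the times `s < u`. -/
lemma abs_integral_pow_mul_mul_le (h : CentredMixingProcess P Y 𝓕 k a M) (hk : 1 ≤ k)
    (ha : 0 < a) {s u η B : ℝ} (hs : 0 < s) (hsu : s < u) (hη : 0 < η)
    (hB : ∫ ω, (∫ r in (0 : ℝ)..s, Y r ω) ^ (2 * k) ∂P ≤ B) :
    |∫ ω, (∫ r in (0 : ℝ)..s, Y r ω) ^ (2 * k - 2) * Y s ω * Y u ω ∂P| ≤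
      Real.exp (-(a / (8 * k)) * (u - s)) * (η * B + η⁻¹ ^ (k - 1) *
        (1 + M + (4 * √a⁻¹ * (2 + M) + M))) := by
  have hk0 : (0 : ℝ) < k := by exact_mod_cast hk
  have hw1 : Real.exp (-(a / (8 * k)) * (u - s)) ≤ 1 := Real.exp_le_one_iff.2
    (mul_nonpos_of_nonpos_of_nonneg (neg_nonpos.2 (by positivity)) (by linarith))
  have hb : 0 < √a⁻¹ := Real.sqrt_pos.2 (inv_pos.2 ha)
  -- with the weight `w = exp (-a (u - s) / (8k))` the mixing rate is `(√a⁻¹ w^(4k))²`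
  have hrate : a⁻¹ * Real.exp (-a * (u - s))
      = (√a⁻¹ * Real.exp (-(a / (8 * k)) * (u - s)) ^ (4 * k)) ^ 2 := by
    rw [mul_pow, Real.sq_sqrt (inv_pos.2 ha).le, ← pow_mul, ← Real.exp_nat_mul]
    congr 2
    push_cast
    field_simp
    ring
  have hev : Even (2 * k) := even_two_mul k
  have hYu : Measurable (Y u) := h.measurable.comp measurable_prodMk_left
  have key := abs_integral_pow_mul_mul_le_of_mixing (h.past_le s) hk
    (h.adapted_integral s hs.le) (h.adapted s)
    hYu (h.integral_pow hk hs le_rfl).1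
    (h.lower_moment hev (by omega) s).1 (h.integrable u) (h.lower_moment hev (by omega) u).1
    (h.lower_moment even_two (by omega) u).1 (h.centred u) hb (Real.exp_pos _) hw1 hη
    (fun A hA B hB => (h.mixing s u hs.le hsu A hA B hB).trans_eq hrate)
  refine key.trans ?_
  have h1 := (h.lower_moment hev (by omega) s).2
  have h2 := (h.lower_moment even_two (by omega) u).2
  have h3 := h.moment_le u
  have h4 : 1 + ∫ ω, Y u ω ^ 2 ∂P ≤ 2 + M := by linarith
  gcongr

/-- The self-bounding step: a bound `B` for the `2k`-th moments of all integrals up to time `T`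
is improved to a bound whose dependence on `B` carries the free factor `η`. -/
lemma integral_pow_le_self (h : CentredMixingProcess P Y 𝓕 k a M) (hk : 1 ≤ k)
    (ha : 0 < a) {T η B : ℝ} (hT : 0 < T) (hη : 0 < η)
    (hB : ∀ s, 0 < s → s ≤ T → ∫ ω, (∫ r in (0 : ℝ)..s, Y r ω) ^ (2 * k) ∂P ≤ B) :
    ∫ ω, (∫ r in (0 : ℝ)..T, Y r ω) ^ (2 * k) ∂P ≤
      2 * k * (2 * k - 1) * (T * (a / (8 * k))⁻¹ * (η * B + η⁻¹ ^ (k - 1) *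
        (1 + M + (4 * √a⁻¹ * (2 + M) + M)))) := by
  have hk0 : (0 : ℝ) < k := by exact_mod_cast hk
  have hk1 : (1 : ℝ) ≤ k := by exact_mod_cast hk
  have hev : Even (2 * k) := even_two_mul k
  set D := η * B + η⁻¹ ^ (k - 1) * (1 + M + (4 * √a⁻¹ * (2 + M) + M)) with hD
  have hM : 0 ≤ M := (integral_nonneg fun ω => (show Even (4 * k) from ⟨2 * k, by ring⟩).pow_nonneg
    (Y 0 ω)).trans (h.moment_le 0)
  have hB0 : 0 ≤ B := (integral_nonneg fun ω => hev.pow_nonneg _).trans (hB T hT le_rfl)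
  have hD0 : 0 ≤ D := by positivity
  set r := a / (8 * k) with hr
  have hr0 : 0 < r := by positivity
  set ρ := volume.restrict (Set.Ioc (0 : ℝ) T) with hρ
  -- the integrand of the iterated-integral formula, written with set integrals, which are jointly
  -- measurable in their upper limit and `ω` without any sign condition on the limit
  set F : (ℝ × ℝ) × Ω → ℝ := fun q => if q.1.2 < q.1.1 then
    (∫ x in Set.Ioc 0 q.1.2, Y x q.2) ^ (2 * k - 2) * Y q.1.2 q.2 * Y q.1.1 q.2 else 0 with hF
  have hFm : Measurable F := by
    have hS : Measurable (fun q : ℝ × Ω => ∫ x in Set.Ioc 0 q.1, Y x q.2) := by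
      have e : (fun q : ℝ × Ω => ∫ x in Set.Ioc 0 q.1, Y x q.2)
          = fun q => ∫ x, ({z : (ℝ × Ω) × ℝ | 0 < z.2 ∧ z.2 ≤ z.1.1}.indicator
            (fun z => Y z.2 z.1.2)) (q, x) := by
        funext q
        rw [← integral_indicator measurableSet_Ioc]
        rfl
      rw [e]
      refine (StronglyMeasurable.integral_prod_right'
        (f := {z : (ℝ × Ω) × ℝ | 0 < z.2 ∧ z.2 ≤ z.1.1}.indicator fun z => Y z.2 z.1.2)
        (Measurable.stronglyMeasurable ?_)).measurable
      refine Measurable.indicator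
        (h.measurable.comp (measurable_snd.prodMk measurable_fst.snd)) ?_
      exact (measurableSet_lt measurable_const measurable_snd).inter
        (measurableSet_le measurable_snd measurable_fst.fst)
    refine Measurable.ite (measurableSet_lt measurable_fst.snd measurable_fst.fst) ?_
      measurable_const
    exact (((hS.comp (measurable_fst.snd.prodMk measurable_snd)).pow_const _).mul
      (h.measurable.comp (measurable_fst.snd.prodMk measurable_snd))).mul
      (h.measurable.comp (measurable_fst.fst.prodMk measurable_snd))
  have hmem : ∀ᵐ p : ℝ × ℝ ∂(ρ.prod ρ), p.1 ∈ Set.Ioc 0 T ∧ p.2 ∈ Set.Ioc 0 T := by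
    rw [hρ, Measure.prod_restrict]
    filter_upwards [ae_restrict_mem (measurableSet_Ioc.prod measurableSet_Ioc)] with p hp using hp
  have hYint := fun s => (h.lower_moment hev (by omega) s).1
  have hFsec : ∀ p : ℝ × ℝ, p.1 ∈ Set.Ioc 0 T → p.2 ∈ Set.Ioc 0 T →
      Integrable (fun ω => F (p, ω)) P ∧ ∫ ω, ‖F (p, ω)‖ ∂P ≤ B + (1 + M) + (1 + M) := by
    intro p hp1 hp2
    have hS := (h.integral_pow hk hp2.1 hp2.2).1
    have hle : ∀ ω, ‖F (p, ω)‖ ≤ (∫ x in (0 : ℝ)..p.2, Y x ω) ^ (2 * k) + Y p.2 ω ^ (2 * k)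
        + Y p.1 ω ^ (2 * k) := fun ω => by
      by_cases hlt : p.2 < p.1
      · simp only [hF, hlt, if_true, intervalIntegral.integral_of_le hp2.1.le]
        exact abs_pow_mul_mul_le hk _ _ _
      · simp only [hF, hlt, if_false, norm_zero]
        have := hev.pow_nonneg (∫ x in (0 : ℝ)..p.2, Y x ω)
        have := hev.pow_nonneg (Y p.2 ω)
        have := hev.pow_nonneg (Y p.1 ω)
        positivity
    have hdom := (hS.add (hYint p.2)).add (hYint p.1)
    have hint : Integrable (fun ω => F (p, ω)) P := Integrable.mono' hdom
      (hFm.comp measurable_prodMk_left).aestronglyMeasurable (ae_of_all _ hle)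
    refine ⟨hint, (integral_mono hint.norm hdom hle).trans ?_⟩
    have e1 := (h.lower_moment hev (by omega) p.2).2
    have e2 := (h.lower_moment hev (by omega) p.1).2
    have e3 := hB p.2 hp2.1 hp2.2
    have e4 := integral_add (hS.add (hYint p.2)) (hYint p.1)
    have e5 := integral_add hS (hYint p.2)
    simp only [Pi.add_apply] at e4 e5 ⊢
    linarith
  have hFint : Integrable F ((ρ.prod ρ).prod P) := by
    refine (integrable_prod_iff hFm.aestronglyMeasurable).2 ⟨?_, ?_⟩
    · filter_upwards [hmem] with p hp using (hFsec p hp.1 hp.2).1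
    · refine Integrable.of_bound
        (hFm.norm.stronglyMeasurable.integral_prod_right').aestronglyMeasurable
        (B + (1 + M) + (1 + M)) ?_
      filter_upwards [hmem] with p hp
      rw [Real.norm_of_nonneg (integral_nonneg fun ω => norm_nonneg _)]
      exact (hFsec p hp.1 hp.2).2
  -- the pathwise formula; taking expectations and swapping leaves the covariances at times `s < u`
  have hpath : ∀ᵐ ω ∂P, (∫ x in (0 : ℝ)..T, Y x ω) ^ (2 * k)
      = (2 * k * (2 * k - 1) : ℝ) * ∫ p, F (p, ω) ∂(ρ.prod ρ) := by
    filter_upwards [(h.integral_abs_pow hk hT).1, hFint.prod_left_ae] with ω hω hFω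
    rw [intervalIntegral_pow_eq_iterated hT.le
      ((intervalIntegrable_iff_integrableOn_Ioc_of_le hT.le).2 hω) hk,
      integral_prod _ hFω]
    congr 1
    refine integral_congr_ae (ae_of_all _ fun u => ?_)
    refine setIntegral_congr_fun measurableSet_Ioc fun s hs => ?_
    simp only [hF, intervalIntegral.integral_of_le hs.1.le]
  set K : ℝ × ℝ → ℝ := fun p => if p.2 < p.1 then Real.exp (-r * (p.1 - p.2)) else 0 with hK
  have hKm : Measurable K := Measurable.ite (measurableSet_lt measurable_snd measurable_fst)
    (by fun_prop) measurable_const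
  have hKint : Integrable K (ρ.prod ρ) := by
    refine Integrable.of_bound hKm.aestronglyMeasurable 1 (ae_of_all _ fun p => ?_)
    by_cases hlt : p.2 < p.1
    · simp only [hK, hlt, if_true, Real.norm_eq_abs, Real.abs_exp]
      exact Real.exp_le_one_iff.2
        (mul_nonpos_of_nonpos_of_nonneg (neg_nonpos.2 hr0.le) (by linarith))
    · simp [hK, hlt]
  have hKle : ∫ p, K p ∂(ρ.prod ρ) ≤ T * r⁻¹ := by
    rw [integral_prod _ hKint]
    have h1 : ∫ u, (∫ s, K (u, s) ∂ρ) ∂ρ ≤ ∫ u in Set.Ioc 0 T, r⁻¹ :=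
      setIntegral_mono_on hKint.integral_prod_left (integrableOn_const (by simp)) measurableSet_Ioc
        fun u hu => setIntegral_exp_kernel_le hr0 hu
    simpa [hT.le] using h1
  have hmain : |∫ p, (∫ ω, F (p, ω) ∂P) ∂(ρ.prod ρ)| ≤ ∫ p, K p * D ∂(ρ.prod ρ) := by
    rw [← Real.norm_eq_abs]
    refine norm_integral_le_of_norm_le (hKint.mul_const D) ?_
    filter_upwards [hmem] with p hp
    by_cases hlt : p.2 < p.1
    · simp only [hF, hK, hlt, if_true]
      have := h.abs_integral_pow_mul_mul_le hk ha hp.2.1 hlt hη (hB p.2 hp.2.1 hp.2.2)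
      simpa only [intervalIntegral.integral_of_le hp.2.1.le, Real.norm_eq_abs] using this
    · simp [hF, hK, hlt]
  rw [integral_congr_ae hpath, integral_const_mul, ← integral_integral_swap (f := fun p ω => F (p, ω)) hFint]
  have hc : 0 ≤ (2 * k * (2 * k - 1) : ℝ) := mul_nonneg (by positivity) (by linarith)
  refine mul_le_mul_of_nonneg_left ?_ hc
  refine (le_abs_self _).trans (hmain.trans ?_)
  rw [integral_mul_const]
  gcongr

/-- **Moment bound.** The `2k`-th moment of the time integral of an exponentially mixing centred
process grows at most like `T ^ k`. Taking the supremum over the times up to `T` in the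
self-bounding step with `η` of order `1 / T`, one absorbs half of that supremum. -/
theorem integral_pow_le (h : CentredMixingProcess P Y 𝓕 k a M) (hk : 1 ≤ k) (ha : 0 < a)
    {T : ℝ} (hT : 0 < T) :
    ∫ ω, (∫ r in (0 : ℝ)..T, Y r ω) ^ (2 * k) ∂P ≤
      (1 + M + (4 * √a⁻¹ * (2 + M) + M)) *
        (2 * (2 * k * (2 * k - 1) * (a / (8 * k))⁻¹)) ^ k * T ^ k := by
  have hk0 : (0 : ℝ) < k := by exact_mod_cast hk
  have hk1 : (1 : ℝ) ≤ k := by exact_mod_cast hk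
  set K := 1 + M + (4 * √a⁻¹ * (2 + M) + M)
  set c := 2 * k * (2 * k - 1) * (a / (8 * k))⁻¹ with hc
  have hc0 : 0 < c := mul_pos (mul_pos (by positivity) (by linarith)) (by positivity)
  set m : ℝ → ℝ := fun s => ∫ ω, (∫ r in (0 : ℝ)..s, Y r ω) ^ (2 * k) ∂P with hm
  set E : Set ℝ := m '' Set.Ioc 0 T with hE
  have hbdd : BddAbove E := ⟨∫ ω, (∫ u in Set.Ioc 0 T, |Y u ω|) ^ (2 * k) ∂P, by
    rintro _ ⟨s, hs, rfl⟩; exact (h.integral_pow hk hs.1 hs.2).2⟩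
  have hTE : m T ∈ E := ⟨T, ⟨hT, le_rfl⟩, rfl⟩
  have hle : ∀ s ∈ Set.Ioc 0 T, m s ≤ sSup E := fun s hs => le_csSup hbdd ⟨s, hs, rfl⟩
  have hsup0 : 0 ≤ sSup E :=
    (integral_nonneg fun ω => (even_two_mul k).pow_nonneg _).trans (hle T ⟨hT, le_rfl⟩)
  have hM : 0 ≤ M := (integral_nonneg fun ω => (show Even (4 * k) from ⟨2 * k, by ring⟩).pow_nonneg
    (Y 0 ω)).trans (h.moment_le 0)
  have hK0 : 0 ≤ K := by positivity
  -- `η = 1 / (2cT)` makes the coefficient of the supremum equal to `1/2`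
  have hη : 0 < (2 * (c * T))⁻¹ := by positivity
  have hself : sSup E ≤ sSup E / 2 + (2 * (c * T)) ^ k / 2 * K := by
    refine csSup_le ⟨_, hTE⟩ ?_
    rintro _ ⟨s, hs, rfl⟩
    have h1 := h.integral_pow_le_self hk ha hs.1 hη (B := sSup E)
      fun x hx hxs => hle x ⟨hx, hxs.trans hs.2⟩
    rw [inv_inv] at h1
    have h2 : 2 * k * (2 * k - 1) * (s * (a / (8 * k))⁻¹ * ((2 * (c * T))⁻¹ * sSup E +
        (2 * (c * T)) ^ (k - 1) * K))
        = c * s * ((2 * (c * T))⁻¹ * sSup E + (2 * (c * T)) ^ (k - 1) * K) := by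
      rw [hc]; ring
    have h3 : c * T * ((2 * (c * T))⁻¹ * sSup E + (2 * (c * T)) ^ (k - 1) * K)
        = sSup E / 2 + (2 * (c * T)) ^ k / 2 * K := by
      obtain ⟨n, rfl⟩ : ∃ n, k = n + 1 := ⟨k - 1, by omega⟩
      rw [Nat.add_sub_cancel, pow_succ]
      field_simp
    refine h1.trans (h2.trans_le (le_trans ?_ h3.le))
    gcongr
    exact hs.2
  have h4 : m T ≤ sSup E := hle T ⟨hT, le_rfl⟩
  have h5 : K * (2 * c) ^ k * T ^ k = (2 * (c * T)) ^ k * K := by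
    rw [mul_assoc, ← mul_pow]; ring
  rw [h5]
  linarith

end CentredMixingProcess

/-! ### Functionals of a stationary mixing process with left-continuous paths -/

/-- A process with left-continuous paths is the pointwise limit of its discretizations at the grid
points `⌊t n⌋ / n ≤ t`, hence jointly measurable. -/
lemma measurable_uncurry_of_leftContinuous {Ω E : Type*} {m : MeasurableSpace Ω}
    [TopologicalSpace E] [TopologicalSpace.PseudoMetrizableSpace E] [MeasurableSpace E]
    [BorelSpace E] {Z : ℝ≥0 → Ω → E} (hZ : ∀ t, Measurable (Z t))
    (hl : ∀ ω t, ContinuousWithinAt (fun s => Z s ω) (Set.Iic t) t) :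
    Measurable (Function.uncurry Z) := by
  let grid : ℕ → ℝ≥0 → ℝ≥0 := fun n t => (⌊(t : ℝ) * n⌋₊ : ℝ≥0) / n
  refine measurable_of_tendsto_metrizable
    (f := fun (n : ℕ) (p : ℝ≥0 × Ω) => Z (grid n p.1) p.2) (fun n => ?_) ?_
  · have h1 : Measurable (fun q : ℕ × Ω => Z ((q.1 : ℝ≥0) / n) q.2) :=
      measurable_from_prod_countable_right fun i => hZ ((i : ℝ≥0) / n)
    have h2 : Measurable (fun p : ℝ≥0 × Ω => (⌊(p.1 : ℝ) * n⌋₊, p.2)) :=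
      (Nat.measurable_floor.comp
        ((measurable_fst.coe_nnreal_real).mul_const (n : ℝ))).prodMk measurable_snd
    exact h1.comp h2
  · refine tendsto_pi_nhds.2 fun p => ?_
    refine (hl p.2 p.1).tendsto.comp (tendsto_nhdsWithin_iff.2 ⟨?_, Eventually.of_forall fun n => ?_⟩)
    · rw [← NNReal.tendsto_coe]
      have := (tendsto_nat_floor_mul_div_atTop (R := ℝ) p.1.coe_nonneg).comp
        tendsto_natCast_atTop_atTop
      simpa [grid, Function.comp_def] using this
    · rw [Set.mem_Iic, ← NNReal.coe_le_coe]
      simp only [grid, NNReal.coe_div, NNReal.coe_natCast]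
      exact div_le_of_le_mul₀ (Nat.cast_nonneg n) p.1.coe_nonneg
        (Nat.floor_le (mul_nonneg p.1.coe_nonneg (Nat.cast_nonneg n)))

section Stationary

variable {Ω E : Type*} [MeasurableSpace E] {X : ℝ≥0 → Ω → E}

lemma measurable_sigmaFieldOn {S : Set ℝ≥0} {t : ℝ≥0} (ht : t ∈ S) :
    Measurable[sigmaFieldOn X S] (X t) :=
  measurable_iff_comap_le.2
    (le_iSup₂ (f := fun t (_ : t ∈ S) => MeasurableSpace.comap (X t) _) t ht)

variable [mΩ : MeasurableSpace Ω] {P : Measure Ω}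

lemma sigmaFieldOn_le (hX : ∀ t, Measurable (X t)) (S : Set ℝ≥0) : sigmaFieldOn X S ≤ mΩ :=
  iSup₂_le fun t _ => (hX t).comap_le

lemma IsStationaryProcess.map_eq (h : IsStationaryProcess P X) (hX : ∀ t, Measurable (X t))
    (t : ℝ≥0) : P.map (X t) = P.map (X 0) := by
  have h1 := congrArg (fun μ => μ.map fun x : ℝ≥0 → E => x 0) (h t)
  rw [Measure.map_map (measurable_pi_apply 0) (measurable_pi_lambda _ fun s => hX _),
    Measure.map_map (measurable_pi_apply 0) (measurable_pi_lambda _ fun s => hX _)] at h1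
  simpa [Function.comp_def] using h1

lemma IsStationaryProcess.integral_comp (h : IsStationaryProcess P X) (hX : ∀ t, Measurable (X t))
    {φ : E → ℝ} (hφ : Measurable φ) (t : ℝ≥0) :
    ∫ ω, φ (X t ω) ∂P = ∫ ω, φ (X 0 ω) ∂P := by
  rw [← integral_map (hX t).aemeasurable hφ.aestronglyMeasurable, h.map_eq hX t,
    integral_map (hX 0).aemeasurable hφ.aestronglyMeasurable]

lemma IsStationaryProcess.integrable_comp (h : IsStationaryProcess P X)
    (hX : ∀ t, Measurable (X t)) {φ : E → ℝ} (hφ : Measurable φ)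
    (h0 : Integrable (fun ω => φ (X 0 ω)) P) (t : ℝ≥0) :
    Integrable (fun ω => φ (X t ω)) P := by
  have h1 : Integrable φ (P.map (X 0)) :=
    (integrable_map_measure hφ.aestronglyMeasurable (hX 0).aemeasurable).2 h0
  rw [← h.map_eq hX t] at h1
  exact (integrable_map_measure hφ.aestronglyMeasurable (hX t).aemeasurable).1 h1

lemma abs_measureReal_inter_sub_le_mixingCoeff [IsProbabilityMeasure P] {t h : ℝ≥0} {A B : Set Ω}
    (hA : MeasurableSet[sigmaFieldOn X (Set.Icc 0 t)] A)
    (hB : MeasurableSet[sigmaFieldOn X (Set.Ici (t + h))] B) :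
    |P.real (A ∩ B) - P.real A * P.real B| ≤ mixingCoeff P X h := by
  refine le_csSup ⟨1, ?_⟩ ⟨t, A, B, hA, hB, rfl⟩
  rintro _ ⟨_, A, B, -, -, rfl⟩
  have h1 : P.real (A ∩ B) ≤ 1 := measureReal_le_one
  have h2 : 0 ≤ P.real (A ∩ B) := measureReal_nonneg
  have h3 : P.real A * P.real B ≤ 1 := mul_le_one₀ measureReal_le_one measureReal_nonneg
    measureReal_le_one
  have h4 : 0 ≤ P.real A * P.real B := mul_nonneg measureReal_nonneg measureReal_nonneg
  rw [abs_le]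
  constructor <;> linarith

/-- The past of the centred functional is generated by `X` on `[0, s]`; its indefinite integral
only involves the stopped process `X_{min(t, s)}`, which is jointly measurable for that past. -/
lemma centredMixingProcess_comp [TopologicalSpace E] [TopologicalSpace.PseudoMetrizableSpace E]
    [BorelSpace E] [IsProbabilityMeasure P] (hX : ∀ t, Measurable (X t))
    (hl : ∀ ω t, ContinuousWithinAt (fun s => X s ω) (Set.Iic t) t)
    (hstat : IsStationaryProcess P X) {a : ℝ}
    (hmix : ∀ h : ℝ≥0, 0 < h → mixingCoeff P X h ≤ a⁻¹ * Real.exp (-a * h))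
    {g : E → ℝ} (hg : Measurable g) (hg1 : Integrable (fun ω => g (X 0 ω)) P) {k : ℕ} {M : ℝ}
    (hgk : Integrable (fun ω => (g (X 0 ω) - ∫ ω', g (X 0 ω') ∂P) ^ (4 * k)) P)
    (hM : ∫ ω, (g (X 0 ω) - ∫ ω', g (X 0 ω') ∂P) ^ (4 * k) ∂P ≤ M) :
    CentredMixingProcess P (fun s ω => g (X s.toNNReal ω) - ∫ ω', g (X 0 ω') ∂P)
      (fun s => sigmaFieldOn X (Set.Icc 0 s.toNNReal)) k a M where
  measurable := ((hg.comp (measurable_uncurry_of_leftContinuous hX hl)).comp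
    ((measurable_real_toNNReal.comp measurable_fst).prodMk measurable_snd)).sub_const _
  past_le s := sigmaFieldOn_le hX _
  adapted s := by
    have h1 : Measurable[sigmaFieldOn X (Set.Icc 0 s.toNNReal)] (X s.toNNReal) :=
      measurable_sigmaFieldOn ⟨zero_le, le_rfl⟩
    exact ((hg.comp h1).sub_const _).stronglyMeasurable
  adapted_integral s hs := by
    let Z : ℝ≥0 → Ω → E := fun t => X (min t s.toNNReal)
    have hZ : Measurable[Prod.instMeasurableSpace (m₂ := sigmaFieldOn X (Set.Icc 0 s.toNNReal))]
        (Function.uncurry Z) := by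
      refine @measurable_uncurry_of_leftContinuous Ω E (sigmaFieldOn X (Set.Icc 0 s.toNNReal))
        _ _ _ _ Z (fun t => measurable_sigmaFieldOn ⟨zero_le, min_le_right _ _⟩) fun ω t => ?_
      refine (hl ω (min t s.toNNReal)).comp (f := fun r => min r s.toNNReal)
        (t := Set.Iic (min t s.toNNReal)) (by fun_prop) fun r hr => ?_
      exact min_le_min_right s.toNNReal (Set.mem_Iic.1 hr)
    have e : (fun ω => ∫ u in (0 : ℝ)..s, (g (X u.toNNReal ω) - ∫ ω', g (X 0 ω') ∂P))
        = fun ω => ∫ u in Set.Ioc 0 s, (g (Z u.toNNReal ω) - ∫ ω', g (X 0 ω') ∂P) := by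
      funext ω
      rw [intervalIntegral.integral_of_le hs]
      refine setIntegral_congr_fun measurableSet_Ioc fun u hu => ?_
      simp only [Z, min_eq_left (Real.toNNReal_le_toNNReal hu.2)]
    rw [e]
    refine @StronglyMeasurable.integral_prod_left' ℝ Ω ℝ _
      (sigmaFieldOn X (Set.Icc 0 s.toNNReal)) (volume.restrict (Set.Ioc 0 s)) _ _ _
      (fun p => g (Z p.1.toNNReal p.2) - ∫ ω', g (X 0 ω') ∂P) (Measurable.stronglyMeasurable ?_)
    exact ((hg.comp hZ).comp (((measurable_real_toNNReal.comp
      (@measurable_fst _ _ _ (sigmaFieldOn X (Set.Icc 0 s.toNNReal))))).prodMk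
      (@measurable_snd _ _ _ (sigmaFieldOn X (Set.Icc 0 s.toNNReal))))).sub_const _
  centred s := by
    rw [integral_sub (hstat.integrable_comp hX hg hg1 _) (integrable_const _),
      hstat.integral_comp hX hg]
    simp
  integrable s := hstat.integrable_comp hX ((hg.sub_const _).pow_const _) hgk _
  moment_le s := (hstat.integral_comp hX ((hg.sub_const _).pow_const (4 * k)) _).trans_le hM
  mixing s t hs hst A hA B hB := by
    have hlt : s.toNNReal < t.toNNReal := (Real.toNNReal_lt_toNNReal_iff (hs.trans_lt hst)).2 hst
    have hcoe : ((t.toNNReal - s.toNNReal : ℝ≥0) : ℝ) = t - s := by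
      rw [NNReal.coe_sub hlt.le, Real.coe_toNNReal t (hs.trans hst.le), Real.coe_toNNReal s hs]
    refine le_trans ?_ ((hmix (t.toNNReal - s.toNNReal) (tsub_pos_of_lt hlt)).trans_eq
      (by rw [hcoe]))
    refine abs_measureReal_inter_sub_le_mixingCoeff hA ?_
    have h1 : Measurable[sigmaFieldOn X (Set.Ici (s.toNNReal + (t.toNNReal - s.toNNReal)))]
        (X t.toNNReal) := measurable_sigmaFieldOn (by
      rw [add_tsub_cancel_of_le hlt.le]; exact Set.self_mem_Ici)
    exact ((hg.comp h1).sub_const _) hB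

end Stationary

/-! ### From even moments to `L^p` norms -/

lemma memLp_and_eLpNorm_le_of_integral_pow_le {Ω : Type*} [MeasurableSpace Ω] {P : Measure Ω}
    [IsProbabilityMeasure P] {S : Ω → ℝ} (hS : AEStronglyMeasurable S P) {k : ℕ} (hk : 1 ≤ k)
    (hint : Integrable (fun ω => S ω ^ (2 * k)) P) {D : ℝ} (hD : 0 ≤ D)
    (hle : ∫ ω, S ω ^ (2 * k) ∂P ≤ D ^ (2 * k)) {p : ℝ} (hp : p ≤ 2 * k) :
    MemLp S (ENNReal.ofReal p) P ∧ eLpNorm S (ENNReal.ofReal p) P ≤ ENNReal.ofReal D := by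
  have hev : Even (2 * k) := even_two_mul k
  have h2k : 2 * k ≠ 0 := by omega
  have hnorm : ∀ ω, ‖S ω‖ ^ (2 * k) = S ω ^ (2 * k) := fun ω => hev.pow_abs _
  have hmem : MemLp S ((2 * k : ℕ) : ℝ≥0∞) P := by
    refine (integrable_norm_rpow_iff hS (by exact_mod_cast h2k) (ENNReal.natCast_ne_top _)).1 ?_
    simp only [ENNReal.toReal_natCast, Real.rpow_natCast, hnorm]
    exact hint
  have hpk : ENNReal.ofReal p ≤ ((2 * k : ℕ) : ℝ≥0∞) := by
    rw [ENNReal.ofReal_le_natCast]; exact_mod_cast hp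
  refine ⟨hmem.mono_exponent hpk, (eLpNorm_le_eLpNorm_of_exponent_le hpk hS).trans ?_⟩
  rw [hmem.eLpNorm_eq_integral_rpow_norm (by exact_mod_cast h2k) (ENNReal.natCast_ne_top _)]
  simp only [ENNReal.toReal_natCast, Real.rpow_natCast, hnorm]
  refine ENNReal.ofReal_le_ofReal ?_
  rw [← Real.pow_rpow_inv_natCast hD h2k]
  exact Real.rpow_le_rpow (integral_nonneg fun ω => hev.pow_nonneg _) hle (by positivity)

/-! ### The intensity triple as a continuous function of the covariate process -/

/-- The covariate vector `x` placed in the `α`-th block of the parameter space: the gradient of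
`η ↦ ∑_j η^α_j x_j`. -/
def blockVector {d J : ℕ} (α : Fin d) (x : Fin J → ℝ) : EuclideanSpace ℝ (Fin d × Fin J) :=
  WithLp.toLp 2 fun q => if q.1 = α then x q.2 else 0

lemma inner_blockVector {d J : ℕ} (α : Fin d) (x : Fin J → ℝ)
    (θ : EuclideanSpace ℝ (Fin d × Fin J)) :
    inner ℝ (blockVector α x) θ = ∑ j, θ (α, j) * x j := by
  simp [blockVector, PiLp.inner_apply, Fintype.sum_prod_type, Finset.sum_ite_irrel]

lemma continuous_blockVector {d J : ℕ} (α : Fin d) :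
    Continuous (blockVector α : (Fin J → ℝ) → EuclideanSpace ℝ (Fin d × Fin J)) := by
  refine (PiLp.continuous_toLp 2 _).comp (continuous_pi fun q => ?_)
  by_cases h : q.1 = α
  · simpa only [h, if_true] using continuous_apply q.2
  · simpa only [h, if_false] using continuous_const

lemma norm_blockVector_le {d J : ℕ} (α : Fin d) (x : Fin J → ℝ) :
    ‖blockVector α x‖ ≤ ∑ j, |x j| := by
  rw [EuclideanSpace.norm_eq]
  refine Real.sqrt_le_iff.2 ⟨Finset.sum_nonneg fun j _ => abs_nonneg _, ?_⟩
  have h1 : ∑ q, ‖blockVector α x q‖ ^ 2 = ∑ j, |x j| ^ 2 := by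
    rw [Fintype.sum_prod_type, Finset.sum_eq_single α]
    · simp [blockVector]
    · intro b _ hb; simp [blockVector, hb]
    · simp
  rw [h1]
  exact Finset.sum_sq_le_sq_sum_of_nonneg fun j _ => abs_nonneg _

/-- The triple `(λ(θ*), λ(θ), ∂_θ λ(θ))` as a function of the value `x` of the covariates. -/
noncomputable def coxState {d J : ℕ} (α : Fin d) (θstar θ : EuclideanSpace ℝ (Fin d × Fin J))
    (x : Fin J → ℝ) : IntensityState (Fin d × Fin J) :=
  (⟨Real.exp (inner ℝ (blockVector α x) θstar), (Real.exp_pos _).le⟩,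
    ⟨Real.exp (inner ℝ (blockVector α x) θ), (Real.exp_pos _).le⟩,
    Real.exp (inner ℝ (blockVector α x) θ) • blockVector α x)

lemma continuous_coxState {d J : ℕ} (α : Fin d) (θstar θ : EuclideanSpace ℝ (Fin d × Fin J)) :
    Continuous (coxState α θstar θ) := by
  have h := continuous_blockVector (J := J) α
  have he : ∀ η : EuclideanSpace ℝ (Fin d × Fin J),
      Continuous fun x : Fin J → ℝ => Real.exp (inner ℝ (blockVector α x) η) := fun η =>
    Real.continuous_exp.comp (h.inner continuous_const)
  exact ((he θstar).subtype_mk _).prodMk (((he θ).subtype_mk _).prodMk ((he θ).smul h))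

lemma intensityTriple_coxIntensity {Ω : Type*} {d J : ℕ} (X : ℝ≥0 → Ω → Fin J → ℝ) (α : Fin d)
    (θstar θ : EuclideanSpace ℝ (Fin d × Fin J)) (t : ℝ≥0) (ω : Ω) :
    intensityTriple (coxIntensity X) θstar α θ t ω = coxState α θstar θ (X t ω) := by
  have hgrad : gradient (fun η => (coxIntensity X α t η ω : ℝ)) θ
      = Real.exp (inner ℝ (blockVector α (X t ω)) θ) • blockVector α (X t ω) := by
    refine HasGradientAt.gradient ?_
    rw [hasGradientAt_iff_hasFDerivAt]
    have h1 : HasFDerivAt (fun η => Real.exp (inner ℝ (blockVector α (X t ω)) η)) _ θ :=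
      ((innerSL ℝ (blockVector α (X t ω))).hasFDerivAt (x := θ)).exp
    have h2 : (fun η => (coxIntensity X α t η ω : ℝ))
        = fun η => Real.exp (inner ℝ (blockVector α (X t ω)) η) := by
      funext η
      rw [inner_blockVector]
      rfl
    rw [h2]
    refine h1.congr_fderiv ?_
    ext η
    simp
  unfold intensityTriple coxState
  rw [hgrad]
  simp only [coxIntensity, inner_blockVector]

/-! ### Exponential moments -/

/-- The sum of the `|x_j|` is at most `J` times the largest of them, which leaves only one-dimensional
exponential moments. -/
lemma exp_mul_sum_abs_le {J : ℕ} (x : Fin J → ℝ) {u : ℝ} (hu : 0 ≤ u) :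
    Real.exp (u * ∑ j, |x j|) ≤ 1 + ∑ j, (Real.exp (u * J * x j) + Real.exp (-(u * J) * x j)) := by
  have hnn : ∀ j, 0 ≤ Real.exp (u * J * x j) + Real.exp (-(u * J) * x j) := fun j => by positivity
  rcases isEmpty_or_nonempty (Fin J) with hJ | hJ
  · simp
  · obtain ⟨i, -, hi⟩ := Finset.exists_max_image Finset.univ (fun j => |x j|) Finset.univ_nonempty
    have h1 : ∑ j, |x j| ≤ J * |x i| := by
      simpa using Finset.sum_le_card_nsmul Finset.univ (fun j => |x j|) |x i| hi
    have h2 : Real.exp (u * ∑ j, |x j|) ≤ Real.exp (u * J * |x i|) := by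
      rw [mul_assoc]; gcongr
    have h3 : Real.exp (u * J * |x i|) ≤ Real.exp (u * J * x i) + Real.exp (-(u * J) * x i) := by
      rcases abs_cases (x i) with ⟨h, _⟩ | ⟨h, _⟩ <;> rw [h]
      · linarith [Real.exp_pos (-(u * J) * x i)]
      · rw [mul_neg, ← neg_mul]; linarith [Real.exp_pos (u * J * x i)]
    have h4 := Finset.single_le_sum (fun j _ => hnn j) (Finset.mem_univ i)
    linarith

lemma integrable_exp_mul_sum_abs {Ω : Type*} [MeasurableSpace Ω] {P : Measure Ω}
    [IsProbabilityMeasure P] {J : ℕ} {ξ : Ω → Fin J → ℝ} (hξ : Measurable ξ)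
    (hexp : ∀ (u : ℝ) (j : Fin J), Integrable (fun ω => Real.exp (u * ξ ω j)) P) {u : ℝ}
    (hu : 0 ≤ u) : Integrable (fun ω => Real.exp (u * ∑ j, |ξ ω j|)) P := by
  refine Integrable.mono' ((integrable_const 1).add (integrable_finsetSum Finset.univ
    fun j _ => (hexp (u * J) j).add (hexp (-(u * J)) j))) ?_ (ae_of_all _ fun ω => ?_)
  · have : ∀ j, Measurable fun ω => ξ ω j := fun j => (measurable_pi_apply j).comp hξ
    exact (Real.measurable_exp.comp ((Finset.measurable_sum _ fun j _ =>
      (this j).abs).const_mul u)).aestronglyMeasurable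
  · rw [Real.norm_of_nonneg (Real.exp_pos _).le]
    simpa using exp_mul_sum_abs_le (ξ ω) hu

/-- A function of polynomial growth of the intensity triple is dominated by an exponential of the
covariates, uniformly over bounded sets of parameters. -/
lemma exists_abs_comp_coxState_le {d J : ℕ} (α : Fin d)
    {f : IntensityState (Fin d × Fin J) → ℝ} (hf : ContinuousPolyGrowth f) (R : ℝ) :
    ∃ A u : ℝ, 0 ≤ A ∧ 0 ≤ u ∧ ∀ θstar θ : EuclideanSpace ℝ (Fin d × Fin J), ‖θstar‖ ≤ R →
      ‖θ‖ ≤ R → ∀ x, |f (coxState α θstar θ x)| ≤ A * Real.exp (u * ∑ j, |x j|) := by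
  obtain ⟨-, C, k, hC⟩ := hf
  refine ⟨|C| * 4 ^ k, k * (|R| + 1), by positivity, by positivity, fun θstar θ hstar hθ x => ?_⟩
  set s := ∑ j, |x j| with hs
  have hs0 : 0 ≤ s := Finset.sum_nonneg fun j _ => abs_nonneg _
  have hv := norm_blockVector_le α x
  have hinner : ∀ η : EuclideanSpace ℝ (Fin d × Fin J), ‖η‖ ≤ R →
      Real.exp (inner ℝ (blockVector α x) η) ≤ Real.exp (|R| * s) := fun η hη => by
    refine Real.exp_le_exp.2 ((real_inner_le_norm _ _).trans ?_)
    rw [mul_comm]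
    exact mul_le_mul (hη.trans (le_abs_self R)) hv (norm_nonneg _) (abs_nonneg _)
  have hone : 1 ≤ Real.exp (|R| * s) := Real.one_le_exp (by positivity)
  have hse : s ≤ Real.exp s := by linarith [Real.add_one_le_exp s]
  have hone' : 1 ≤ Real.exp s := Real.one_le_exp hs0
  have hsplit : Real.exp ((|R| + 1) * s) = Real.exp (|R| * s) * Real.exp s := by
    rw [← Real.exp_add]; ring_nf
  have h1 : Real.exp (|R| * s) ≤ Real.exp ((|R| + 1) * s) := by
    rw [hsplit]; exact le_mul_of_one_le_right (Real.exp_pos _).le hone'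
  have hz : ‖Real.exp (inner ℝ (blockVector α x) θ) • blockVector α x‖
      ≤ Real.exp ((|R| + 1) * s) := by
    rw [norm_smul, Real.norm_of_nonneg (Real.exp_pos _).le, hsplit]
    exact mul_le_mul (hinner θ hθ) (hv.trans hse) (norm_nonneg _) (Real.exp_pos _).le
  have hsum : 1 + Real.exp (inner ℝ (blockVector α x) θstar)
      + Real.exp (inner ℝ (blockVector α x) θ)
      + ‖Real.exp (inner ℝ (blockVector α x) θ) • blockVector α x‖
      ≤ 4 * Real.exp ((|R| + 1) * s) := by
    linarith [hinner θstar hstar, hinner θ hθ]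
  have hbase := hC (coxState α θstar θ x).1 (coxState α θstar θ x).2.1 (coxState α θstar θ x).2.2
  refine hbase.trans ?_
  have hpow : (1 + Real.exp (inner ℝ (blockVector α x) θstar)
      + Real.exp (inner ℝ (blockVector α x) θ)
      + ‖Real.exp (inner ℝ (blockVector α x) θ) • blockVector α x‖) ^ k
      ≤ 4 ^ k * Real.exp (k * (|R| + 1) * s) := by
    refine (pow_le_pow_left₀ (by positivity) hsum k).trans_eq ?_
    rw [mul_pow, ← Real.exp_nat_mul, mul_assoc]
  rw [mul_assoc |C|]
  exact mul_le_mul (le_abs_self C) hpow (by positivity) (abs_nonneg C)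

/-! ### The rate of convergence of time averages -/

section TimeAverage

variable {Ω : Type*} {d J : ℕ} {X : ℝ≥0 → Ω → Fin J → ℝ} {α : Fin d}
  {f : IntensityState (Fin d × Fin J) → ℝ}

/-- On the paths that are integrable up to time `T`, centring commutes with the time average. -/
lemma timeAverage_sub_eq {θstar θ : EuclideanSpace ℝ (Fin d × Fin J)} {c T : ℝ} (hT : 0 < T) {ω : Ω}
    (hω : IntegrableOn (fun s : ℝ => f (coxState α θstar θ (X s.toNNReal ω)) - c)
      (Set.Ioc 0 T)) :
    IntervalIntegrable
      (fun t : ℝ => f (intensityTriple (coxIntensity X) θstar α θ t.toNNReal ω)) volume 0 T ∧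
    timeAverage (coxIntensity X) θstar f α θ T ω - c
      = T⁻¹ * ∫ s in (0 : ℝ)..T, (f (coxState α θstar θ (X s.toNNReal ω)) - c) := by
  have h1 : IntervalIntegrable (fun s : ℝ => f (coxState α θstar θ (X s.toNNReal ω))) volume 0 T := by
    have h2 : IntervalIntegrable (fun s : ℝ => f (coxState α θstar θ (X s.toNNReal ω)) - c)
      volume 0 T := (intervalIntegrable_iff_integrableOn_Ioc_of_le hT.le).2 hω
    simpa using h2.add (intervalIntegrable_const (c := c))
  simp only [timeAverage, intensityTriple_coxIntensity]
  refine ⟨h1, ?_⟩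
  rw [intervalIntegral.integral_sub h1 intervalIntegrable_const, intervalIntegral.integral_const,
    smul_eq_mul, sub_zero, mul_sub, inv_mul_cancel_left₀ hT.ne']

variable [MeasurableSpace Ω] {P : Measure Ω} [IsProbabilityMeasure P]

lemma measurable_comp_coxState (hf : ContinuousPolyGrowth f)
    (θstar θ : EuclideanSpace ℝ (Fin d × Fin J)) :
    Measurable fun x => f (coxState α θstar θ x) :=
  (hf.1.comp (continuous_coxState α θstar θ)).measurable

/-- Over a bounded set of parameters, the centred functionals of the intensity triple are centred
mixing processes with common moment bounds. -/
lemma exists_centredMixingProcess_cox (hX_meas : ∀ t, Measurable (X t))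
    (hX_left : ∀ ω t, ContinuousWithinAt (fun s => X s ω) (Set.Iic t) t)
    (hX_stat : IsStationaryProcess P X)
    (hX_exp : ∀ (u : ℝ) (j : Fin J), Integrable (fun ω => Real.exp (u * X 0 ω j)) P) {a : ℝ}
    (hX_mix : ∀ h : ℝ≥0, 0 < h → mixingCoeff P X h ≤ a⁻¹ * Real.exp (-a * h))
    (hf : ContinuousPolyGrowth f) (R : ℝ) (k : ℕ) :
    ∃ M : ℝ, ∀ θstar θ : EuclideanSpace ℝ (Fin d × Fin J), ‖θstar‖ ≤ R → ‖θ‖ ≤ R →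
      Integrable (fun ω => f (coxState α θstar θ (X 0 ω))) P ∧
      CentredMixingProcess P (fun s ω => f (coxState α θstar θ (X s.toNNReal ω))
          - ∫ ω', f (coxState α θstar θ (X 0 ω')) ∂P)
        (fun s => sigmaFieldOn X (Set.Icc 0 s.toNNReal)) k a M := by
  obtain ⟨A, u, hA, hu, hle⟩ := exists_abs_comp_coxState_le α hf R
  set e : Ω → ℝ := fun ω => Real.exp (u * ∑ j, |X 0 ω j|) with he
  have heint : Integrable e P := integrable_exp_mul_sum_abs (hX_meas 0) hX_exp hu
  have hone : ∀ ω, 1 ≤ e ω := fun ω => Real.one_le_exp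
    (mul_nonneg hu (Finset.sum_nonneg fun j _ => abs_nonneg _))
  have hekint : Integrable (fun ω => e ω ^ (4 * k)) P := by
    have := integrable_exp_mul_sum_abs (hX_meas 0) hX_exp (u := (4 * k : ℕ) * u) (by positivity)
    simpa only [he, ← Real.exp_nat_mul, mul_assoc] using this
  set L := A * ∫ ω, e ω ∂P with hL
  refine ⟨(A + L) ^ (4 * k) * ∫ ω, e ω ^ (4 * k) ∂P, fun θstar θ hstar hθ => ?_⟩
  have hg := measurable_comp_coxState (α := α) hf θstar θ
  have hgX : Measurable fun ω => f (coxState α θstar θ (X 0 ω)) := hg.comp (hX_meas 0)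
  have hg1 : Integrable (fun ω => f (coxState α θstar θ (X 0 ω))) P :=
    Integrable.mono' (heint.const_mul A) hgX.aestronglyMeasurable
      (ae_of_all _ fun ω => hle θstar θ hstar hθ _)
  have hL0 : 0 ≤ L := mul_nonneg hA (integral_nonneg fun ω => (Real.exp_pos _).le)
  have hmean : |∫ ω, f (coxState α θstar θ (X 0 ω)) ∂P| ≤ L := by
    rw [hL, ← integral_const_mul, ← Real.norm_eq_abs]
    exact norm_integral_le_of_norm_le (heint.const_mul A)
      (ae_of_all _ fun ω => hle θstar θ hstar hθ (X 0 ω))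
  have hev : Even (4 * k) := ⟨2 * k, by ring⟩
  have hpt : ∀ ω, (f (coxState α θstar θ (X 0 ω))
      - ∫ ω', f (coxState α θstar θ (X 0 ω')) ∂P) ^ (4 * k)
      ≤ (A + L) ^ (4 * k) * e ω ^ (4 * k) := fun ω => by
    rw [← hev.pow_abs, ← mul_pow]
    refine pow_le_pow_left₀ (abs_nonneg _) ((abs_sub _ _).trans ?_) _
    have h1 := hle θstar θ hstar hθ (X 0 ω)
    have h2 : L ≤ L * e ω := le_mul_of_one_le_right hL0 (hone ω)
    rw [add_mul]
    exact add_le_add h1 (hmean.trans h2)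
  have hgk : Integrable (fun ω => (f (coxState α θstar θ (X 0 ω))
      - ∫ ω', f (coxState α θstar θ (X 0 ω')) ∂P) ^ (4 * k)) P :=
    Integrable.mono' (hekint.const_mul _) ((hgX.sub_const _).pow_const _).aestronglyMeasurable
      (ae_of_all _ fun ω => by rw [Real.norm_of_nonneg (hev.pow_nonneg _)]; exact hpt ω)
  refine ⟨hg1, centredMixingProcess_comp hX_meas hX_left hX_stat hX_mix hg hg1 hgk ?_⟩
  rw [← integral_const_mul]
  exact integral_mono hgk (hekint.const_mul _) hpt

/-- The moment bound for the `2k`-th moments with `p ≤ 2k` gives the rate `T^{-1/2}` in `L^p`. -/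
theorem timeAverage_rate (hX_meas : ∀ t, Measurable (X t))
    (hX_left : ∀ ω t, ContinuousWithinAt (fun s => X s ω) (Set.Iic t) t)
    (hX_stat : IsStationaryProcess P X)
    (hX_exp : ∀ (u : ℝ) (j : Fin J), Integrable (fun ω => Real.exp (u * X 0 ω j)) P)
    {a : ℝ} (ha : 0 < a) (hX_mix : ∀ h : ℝ≥0, 0 < h → mixingCoeff P X h ≤ a⁻¹ * Real.exp (-a * h))
    (hf : ContinuousPolyGrowth f) (R p : ℝ) :
    ∃ C : ℝ, ∀ θstar θ : EuclideanSpace ℝ (Fin d × Fin J), ‖θstar‖ ≤ R → ‖θ‖ ≤ R →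
      Integrable (fun ω => f (intensityTriple (coxIntensity X) θstar α θ 0 ω)) P ∧
      ∀ T : ℝ, 0 < T →
        (∀ᵐ ω ∂P, IntervalIntegrable
          (fun t : ℝ => f (intensityTriple (coxIntensity X) θstar α θ t.toNNReal ω)) volume 0 T) ∧
        MemLp (timeAverage (coxIntensity X) θstar f α θ T) (ENNReal.ofReal p) P ∧
        eLpNorm (fun ω => timeAverage (coxIntensity X) θstar f α θ T ω
            - ∫ ω', f (intensityTriple (coxIntensity X) θstar α θ 0 ω') ∂P)
          (ENNReal.ofReal p) P ≤ ENNReal.ofReal (C * T ^ (-(1 / 2) : ℝ)) := by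
  -- `k` is at least `1` and `p ≤ 2k`
  set k := max 1 ⌈p⌉₊
  have hk1 : 1 ≤ k := le_max_left _ _
  have hpk : p ≤ 2 * k := by
    have h1 : p ≤ (⌈p⌉₊ : ℝ) := Nat.le_ceil p
    have h2 : ((⌈p⌉₊ : ℕ) : ℝ) ≤ k := by exact_mod_cast le_max_right _ _
    have h3 : (0 : ℝ) ≤ k := k.cast_nonneg
    linarith
  obtain ⟨M, hM⟩ := exists_centredMixingProcess_cox (α := α) hX_meas hX_left hX_stat hX_exp hX_mix
    hf R k
  set G := (1 + M + (4 * √a⁻¹ * (2 + M) + M)) *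
    (2 * (2 * k * (2 * k - 1) * (a / (8 * k))⁻¹)) ^ k with hG
  refine ⟨|G| ^ (((2 * k : ℕ) : ℝ)⁻¹), fun θstar θ hstar hθ => ?_⟩
  obtain ⟨hint, hproc⟩ := hM θstar θ hstar hθ
  simp only [intensityTriple_coxIntensity X α θstar θ 0]
  refine ⟨hint, fun T hT => ?_⟩
  set c := ∫ ω', f (coxState α θstar θ (X 0 ω')) ∂P with hc
  have hae := (hproc.integral_abs_pow hk1 hT).1
  have heq : (fun ω => timeAverage (coxIntensity X) θstar f α θ T ω - c) =ᵐ[P]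
      fun ω => T⁻¹ * ∫ s in (0 : ℝ)..T, (f (coxState α θstar θ (X s.toNNReal ω)) - c) :=
    hae.mono fun ω hω => (timeAverage_sub_eq hT hω).2
  have hSm : AEStronglyMeasurable
      (fun ω => T⁻¹ * ∫ s in (0 : ℝ)..T, (f (coxState α θstar θ (X s.toNNReal ω)) - c)) P :=
    (((hproc.adapted_integral T hT.le).mono (hproc.past_le T)).const_mul T⁻¹).aestronglyMeasurable
  have hTpow : (T ^ (-(1 / 2) : ℝ)) ^ (2 * k) = T⁻¹ ^ (2 * k) * T ^ k := by
    rw [← Real.rpow_natCast, ← Real.rpow_mul hT.le]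
    have e1 : (-(1 / 2) : ℝ) * ((2 * k : ℕ) : ℝ) = -(k : ℝ) := by push_cast; ring
    rw [e1, Real.rpow_neg hT.le, Real.rpow_natCast, two_mul, pow_add, mul_assoc, ← mul_pow,
      inv_mul_cancel₀ hT.ne', one_pow, mul_one, inv_pow]
  have hbound := hproc.integral_pow_le hk1 ha hT
  have hint2k := (hproc.integral_pow hk1 hT le_rfl).1
  have hfin := memLp_and_eLpNorm_le_of_integral_pow_le (P := P) hSm hk1
    (D := |G| ^ (((2 * k : ℕ) : ℝ)⁻¹) * T ^ (-(1 / 2) : ℝ)) (by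
      simp only [mul_pow]; exact hint2k.const_mul _) (by positivity) (by
      simp only [mul_pow]
      rw [integral_const_mul, Real.rpow_inv_natCast_pow (abs_nonneg G) (by omega), hTpow]
      calc _ ≤ T⁻¹ ^ (2 * k) * (G * T ^ k) := by gcongr
        _ ≤ T⁻¹ ^ (2 * k) * (|G| * T ^ k) := by gcongr; exact le_abs_self G
        _ = _ := by ring) hpk
  refine ⟨hae.mono fun ω hω => (timeAverage_sub_eq hT hω).1, ?_, ?_⟩
  · have h1 := ((memLp_congr_ae heq).2 hfin.1).add (memLp_const c)
    refine (memLp_congr_ae (ae_of_all _ fun ω => ?_)).1 h1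
    simp
  · rw [eLpNorm_congr_ae heq]
    exact hfin.2

end TimeAverage

lemma continuousPolyGrowth_of_bounded {κ : Type*} [Fintype κ] (f : IntensityState κ →ᵇ ℝ) :
    ContinuousPolyGrowth f :=
  ⟨f.continuous, ‖f‖, 0, fun x y z => by simpa using f.norm_coe_le_norm (x, y, z)⟩

/-! ### The ergodic-limit condition and the rate for Cox-type intensities -/

theorem mainTheorem8 {Ω : Type*} [MeasurableSpace Ω] (P : Measure Ω) [IsProbabilityMeasure P]
    {d J : ℕ} (X : ℝ≥0 → Ω → Fin J → ℝ)
    (hX_meas : ∀ t, Measurable (X t))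
    (hX_left : ∀ ω t, ContinuousWithinAt (fun s => X s ω) (Set.Iic t) t)
    (hX_stat : IsStationaryProcess P X)
    (hX_exp : ∀ (u : ℝ) (j : Fin J), Integrable (fun ω => Real.exp (u * X 0 ω j)) P)
    (hX_mix : ∃ a : ℝ, 0 < a ∧ ∀ h : ℝ≥0, 0 < h →
      mixingCoeff P X h ≤ a⁻¹ * Real.exp (-a * h))
    (Θ : Set (EuclideanSpace ℝ (Fin d × Fin J))) (hΘ_open : IsOpen Θ)
    (hΘ_bdd : Bornology.IsBounded Θ)
    (θstar : EuclideanSpace ℝ (Fin d × Fin J)) (hθstar : θstar ∈ Θ) :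
    ErgodicLimitCondition P (coxIntensity X) Θ θstar ∧
    ∀ (α : Fin d) (f : IntensityState (Fin d × Fin J) → ℝ), ContinuousPolyGrowth f →
      (∀ θ ∈ Θ, Integrable (fun ω => f (intensityTriple (coxIntensity X) θstar α θ 0 ω)) P) ∧
      (∀ θ ∈ Θ, ∀ T : ℝ, 0 < T → ∀ᵐ ω ∂P, IntervalIntegrable
        (fun t : ℝ => f (intensityTriple (coxIntensity X) θstar α θ t.toNNReal ω)) volume 0 T) ∧
      ∀ p : ℝ, 1 ≤ p →
        (∀ θ ∈ Θ, ∀ T : ℝ, 0 < T →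
          MemLp (timeAverage (coxIntensity X) θstar f α θ T) (ENNReal.ofReal p) P) ∧
        ∃ C : ℝ, ∀ T : ℝ, 1 ≤ T → ∀ θ ∈ Θ,
          eLpNorm (fun ω => timeAverage (coxIntensity X) θstar f α θ T ω
              - ∫ ω', f (intensityTriple (coxIntensity X) θstar α θ 0 ω') ∂P)
            (ENNReal.ofReal p) P ≤ ENNReal.ofReal (C * T ^ (-(1 / 2) : ℝ)) := by
  obtain ⟨a, ha, hmix⟩ := hX_mix
  obtain ⟨R, hR⟩ := hΘ_bdd.exists_norm_le
  refine ⟨?_, fun α f hf => ⟨fun θ hθ => ?_, fun θ hθ T hT => ?_, fun p _ => ?_⟩⟩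
  · -- The limit measure is the law of the triple at time `0`. The rate `T^{-1/2}` beats `T^δ` for
    -- every `δ < 1/2`; here `δ = 1/4`.
    have hlaw : ∀ α θ, Measurable fun ω => intensityTriple (coxIntensity X) θstar α θ 0 ω := by
      intro α θ
      simp only [intensityTriple_coxIntensity]
      exact (continuous_coxState α θstar θ).measurable.comp (hX_meas 0)
    refine ⟨fun α θ => ⟨P.map fun ω => intensityTriple (coxIntensity X) θstar α θ 0 ω,
      Measure.isProbabilityMeasure_map (hlaw α θ).aemeasurable⟩, 1 / 4, by norm_num, by norm_num,
      fun α p _ f => ?_⟩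
    obtain ⟨C, hC⟩ := timeAverage_rate (α := α) hX_meas hX_left hX_stat hX_exp ha hmix
      (continuousPolyGrowth_of_bounded f) R p
    have hlim : Tendsto (fun T : ℝ => ENNReal.ofReal (C * T ^ (-(1 / 4) : ℝ))) atTop (𝓝 0) := by
      have h1 : Tendsto (fun T : ℝ => C * T ^ (-(1 / 4) : ℝ)) atTop (𝓝 (C * 0)) :=
        (tendsto_rpow_neg_atTop (by norm_num)).const_mul C
      simpa using ENNReal.tendsto_ofReal h1
    refine tendsto_of_tendsto_of_tendsto_of_le_of_le' tendsto_const_nhds hlim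
      (Eventually.of_forall fun T => zero_le) ?_
    filter_upwards [eventually_gt_atTop 0] with T hT
    refine iSup₂_le fun θ hθ => ?_
    have hmean : ∫ w, f w ∂(P.map fun ω => intensityTriple (coxIntensity X) θstar α θ 0 ω)
        = ∫ ω, f (intensityTriple (coxIntensity X) θstar α θ 0 ω) ∂P :=
      integral_map (hlaw α θ).aemeasurable f.continuous.aestronglyMeasurable
    have hexp : T ^ (1 / 4 : ℝ) * (C * T ^ (-(1 / 2) : ℝ)) = C * T ^ (-(1 / 4) : ℝ) := by
      rw [mul_left_comm, ← Real.rpow_add hT]; norm_num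
    rw [ProbabilityMeasure.coe_mk, hmean, ← hexp, ENNReal.ofReal_mul (by positivity)]
    gcongr
    exact ((hC θstar θ (hR _ hθstar) (hR _ hθ)).2 T hT).2.2
  · obtain ⟨C, hC⟩ := timeAverage_rate (α := α) hX_meas hX_left hX_stat hX_exp ha hmix hf R 1
    exact (hC θstar θ (hR _ hθstar) (hR _ hθ)).1
  · obtain ⟨C, hC⟩ := timeAverage_rate (α := α) hX_meas hX_left hX_stat hX_exp ha hmix hf R 1
    exact ((hC θstar θ (hR _ hθstar) (hR _ hθ)).2 T hT).1
  · obtain ⟨C, hC⟩ := timeAverage_rate (α := α) hX_meas hX_left hX_stat hX_exp ha hmix hf R p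
    exact ⟨fun θ hθ T hT => ((hC θstar θ (hR _ hθstar) (hR _ hθ)).2 T hT).2.1,
      C, fun T hT θ hθ => ((hC θstar θ (hR _ hθstar) (hR _ hθ)).2 T (by linarith)).2.2⟩
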